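/- Let $\Lambda=\{\sum_{l\ge 0}a_lT^{\lambda_l} : a_l\in\mathbb Z/2,\ \lambda_l\in\mathbb R,\ \lim_l\lambda_l=+\infty\}$ be the universal Novikov field over $\mathbb Z/2$. **$\mathcal C^0$-manifolds.** A $\mathcal C^0$-manifold with boundary is a finite disjoint union $X=\bigsqcup_{m=0}^N X_m$, where $X_m$ is a second countable Hausdorff space locally homeomorphic to open subsets of $[0,\infty)\times\mathbb R^{m-1}$ (of a point if $m=0$). Its boundary $\partial X$ is the union of the preimages of $\{0\}\times\mathbb R^{m-1}$ under the charts, and $X^\circ=X\setminus\partial X$. A system of boundary faces for $X$ is a finite collection of $\mathcal C^0$-embeddings $\phi_i:F_i\to X$ of $\mathcal C^0$-manifolds with boundary such that $\phi_i(F_i)\subset\partial X$, the sets $\phi_i(F_i^\circ)$ are open in $\partial X$ and pairwise disjoint, and $\overline{\bigcup_i\phi_i(F_i^\circ)}=\partial X$. **Flow categories.** A regularized $A_\infty$-flow category $\mathscr C$ in the $(\mathcal C^0,\text{Morse})$-framework consists of a set $\mathrm{Ob}$; finite sets $\mathrm{Mor}(L,L')$ for $L,L'\in\mathrm{Ob}$;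 for all $n\ge0$ and $L^0,\dots,L^n\in\mathrm{Ob}$ a $\mathcal C^0$-manifold with boundary $\mathcal X(L^0,\dots,L^n)$ with a locally constant energy function $\mathcal E$ all of whose sublevel sets $\mathcal E^{-1}((-\infty,E])$ are compact, and continuous maps $\alpha^k:\mathcal X(L^0,\dots,L^n)\to\mathrm{Mor}(L^{k-1},L^k)$ ($1\le k\le n$), $\beta:\mathcal X(L^0,\dots,L^n)\to\mathrm{Mor}(L^0,L^n)$ and $p:\mathcal X(L^0,\dots,L^n)\to K_n$, where $K_n$ is the $(n-2)$-dimensional associahedron (a point for $n\le 2$); and, for all $s,t\ge0$ with $s+t\le n$, $\mathcal C^0$-embeddings $$\varphi^{s,t}:\mathcal X(L^0,\dots,L^s,L^{s+t},\dots,L^n)\;{}_{\alpha^{s+1}}\!\times_{\beta}\;\mathcal X(L^s,\dots,L^{s+t})\to\mathcal X(L^0,\dots,L^n).$$ Writing $\chi=\varphi^{s,t}(\chi',\chi'')$, these are required to satisfy: 1. $p(\chi)=\sigma_{s+1}(p(\chi'),p(\chi''))$, where $\sigma_{s+1}:K_{n-t+1}\times K_t\to K_n$ is the operadic composition (for $t=0$: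 the map forgetting the $(s+1)$-st point); 2. $\beta(\chi)=\beta(\chi')$; $\alpha^k(\chi)=\alpha^k(\chi')$ for $k\le s$; $\alpha^k(\chi)=\alpha^{k-s}(\chi'')$ for $s+1\le k\le s+t$; $\alpha^k(\chi)=\alpha^{k-t+1}(\chi')$ for $k\ge s+t+1$; and $\mathcal E(\chi)=\mathcal E(\chi')+\mathcal E(\chi'')$; 3. for all $L^0,\dots,L^n$ the maps $\varphi^{s,t}$ with $s+t\le n$ form a system of boundary faces for $\mathcal X(L^0,\dots,L^n)$; 4. the maps $\varphi^{s,t}$ are associative, both for an insertion within an insertion and for two independent insertions. **Linear categories.** A (curved) $\Lambda$-linear $A_\infty$-category consists of a set of objects, $\Lambda$-modules $M(L,L')$, and $\Lambda$-multilinear maps $\mu_n:M(L^0,L^1)\times\dots\times M(L^{n-1},L^n)\to M(L^0,L^n)$ for all $n\ge 0$ and all objects $L^0,\dots,L^n$, such that for all $n\ge0$ and all $x_k\in M(L^{k-1},L^k)$ $$\sum_{s,t\ge 0,\ s+t\le n}\mu_{n-t+1}\bigl(x_1,\dots,x_s,\mu_t(x_{s+1},\dots,x_{s+t}),x_{s+t+1},\dots,x_n\bigr)=0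 .$$ **Proposition.** Let $\mathscr C$ be a regularized $A_\infty$-flow category in the $(\mathcal C^0,\text{Morse})$-framework. For all $n\ge0$, objects $L^0,\dots,L^n$, $p_k\in\mathrm{Mor}(L^{k-1},L^k)$ and $q\in\mathrm{Mor}(L^0,L^n)$ let $\mathcal X(p_1,\dots,p_n,q)_0$ be the set of points $\chi$ of the $0$-dimensional part $\mathcal X(L^0,\dots,L^n)_0$ with $\alpha^k(\chi)=p_k$ for all $k$ and $\beta(\chi)=q$. Then each set $\{\chi\in\mathcal X(p_1,\dots,p_n,q)_0 : \mathcal E(\chi)\le E\}$, $E\in\mathbb R$, is finite, so that the Novikov count $$\langle p_1\otimes\dots\otimes p_n,q\rangle=\sum_{E\in\mathbb R}\#_{\mathbb Z/2}\{\chi\in\mathcal X(p_1,\dots,p_n,q)_0:\mathcal E(\chi)=E\}\;T^{E}\in\Lambda$$ is well defined; and there is exactly one curved $\Lambda$-linear $A_\infty$-category with the same set of objects, with morphism modules $\bigoplus_{p\in\mathrm{Mor}(L,L')}\Lambda\,p$, and with $$\mu_n(p_1,\dots,p_n)=\sum_{q\in\mathrm{Mor}(L^0,L^n)}\langle p_1\otimes\dots\otimes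 p_n,q\rangle\,q$$ for all generators $p_1,\dots,p_n$. -/

import Mathlib

universe u v w

noncomputable section

namespace AInfty

/-! ### The universal Novikov field over `ℤ/2` -/

/-- The universal Novikov field `Λ`: formal series `∑ a_l T^{λ_l}` with `a_l ∈ ℤ/2`, `λ_l ∈ ℝ`,
`λ_l → +∞`, i.e. the Hahn series with only finitely many exponents below any given bound.
(Only its commutative ring structure is used.) -/
def novikovSubring : Subring (HahnSeries ℝ (ZMod 2)) where
  carrier := {f | ∀ E : ℝ, (f.support ∩ Set.Iic E).Finite}
  zero_mem' := fun E => by simp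
  one_mem' := fun E => by
    refine (Set.finite_singleton (0 : ℝ)).subset ?_
    rintro x ⟨hx, -⟩
    by_contra h
    exact hx (by simp [HahnSeries.coeff_one, show x ≠ 0 from h])
  add_mem' := fun {f g} hf hg E => by
    refine ((hf E).union (hg E)).subset ?_
    rintro x ⟨hx, hE⟩
    by_cases h : f.coeff x = 0
    · refine Or.inr ⟨fun h' => hx ?_, hE⟩
      rw [HahnSeries.coeff_add, h, h', add_zero]
    · exact Or.inl ⟨h, hE⟩
  neg_mem' := fun {f} hf E => by
    rw [HahnSeries.support_neg]
    exact hf E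
  mul_mem' := fun {f g} hf hg E => by
    by_cases hf0 : f = 0
    · simp [hf0]
    by_cases hg0 : g = 0
    · simp [hg0]
    refine (Set.Finite.image2 (· + ·) (hf (E - g.order)) (hg (E - f.order))).subset ?_
    rintro x ⟨hx, hE⟩
    obtain ⟨a, ha, b, hb, rfl⟩ := Set.mem_add.1 (HahnSeries.support_mul_subset hx)
    have hE' : a + b ≤ E := hE
    have h1 : f.order ≤ a := HahnSeries.order_le_of_coeff_ne_zero ha
    have h2 : g.order ≤ b := HahnSeries.order_le_of_coeff_ne_zero hb
    exact ⟨a, ⟨ha, by simp only [Set.mem_Iic]; linarith⟩,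
      b, ⟨hb, by simp only [Set.mem_Iic]; linarith⟩, rfl⟩

/-- The universal Novikov field, as a commutative ring. -/
abbrev Novikov : Type := novikovSubring

instance : CharP (HahnSeries ℝ (ZMod 2)) 2 :=
  charP_of_injective_ringHom (f := (HahnSeries.C : ZMod 2 →+* HahnSeries ℝ (ZMod 2)))
    HahnSeries.C_injective 2

instance : CharP Novikov 2 :=
  (novikovSubring.subtype.charP_iff Subtype.val_injective 2).2 inferInstance

/-- The coefficient of `T ^ E` of an element of the Novikov field. -/
def Novikov.coeff (a : Novikov) (E : ℝ) : ZMod 2 := a.1.coeff E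

/-- `HasNovikovCount energy a`: the Novikov count of the (discrete) set `Y` with energy function
`energy` is well defined, i.e. every sublevel set is finite (so the energy values are
`E₀ < E₁ < ⋯`, finite in number or tending to `+∞`, with finite level sets), and it is
`a = ∑ #_{ℤ/2} energy⁻¹(E_l) T^{E_l}`. -/
def HasNovikovCount {Y : Type*} (energy : Y → ℝ) (a : Novikov) : Prop :=
  (∀ E : ℝ, {y | energy y ≤ E}.Finite) ∧
    ∀ E : ℝ, a.coeff E = (Nat.card {y : Y // energy y = E} : ZMod 2)

/-! ### `C⁰`-manifolds with boundary -/

/-- The half-space `[0,∞) × ℝ^{n-1}` (a point if `n = 0`). -/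
abbrev HalfSpace (n : ℕ) : Type := {x : Fin n → ℝ // ∀ i : Fin n, i.val = 0 → 0 ≤ x i}

/-- The boundary `{0} × ℝ^{n-1}` of the half-space (empty if `n = 0`). -/
def HalfSpace.boundary (n : ℕ) : Set (HalfSpace n) := {x | ∃ i : Fin n, i.val = 0 ∧ x.1 i = 0}

/-- A `C⁰`-manifold with boundary: a finite disjoint union of `C⁰`-manifolds with boundary `X_n` of
dimension `n`, where `X_n = {x | dim x = n}`. All local homeomorphisms to half-spaces serve as
charts: they form the maximal `C⁰`-atlas. -/
class C0Manifold (X : Type*) [TopologicalSpace X] where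
  t2 : T2Space X
  secondCountable : SecondCountableTopology X
  dim : X → ℕ
  isLocallyConstant_dim : IsLocallyConstant dim
  dim_bounded : ∃ N, ∀ x, dim x ≤ N
  exists_chart : ∀ x, ∃ e : OpenPartialHomeomorph X (HalfSpace (dim x)), x ∈ e.source

namespace C0Manifold

/-- The boundary `∂X`: the union of the preimages of the boundary of the half-space under the
charts. -/
def boundary (X : Type*) [TopologicalSpace X] [C0Manifold X] : Set X :=
  {x | ∃ e : OpenPartialHomeomorph X (HalfSpace (dim x)),
    x ∈ e.source ∧ e x ∈ HalfSpace.boundary (dim x)}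

/-- The interior `X° = X \ ∂X`. -/
def interior (X : Type*) [TopologicalSpace X] [C0Manifold X] : Set X := (boundary X)ᶜ

end C0Manifold

/-- A system of (codimension 1) boundary faces `φ i : F i → X`. -/
structure IsBoundaryFaceSystem {ι : Type*} [Finite ι] {F : ι → Type*}
    [∀ i, TopologicalSpace (F i)] [∀ i, C0Manifold (F i)]
    {X : Type*} [TopologicalSpace X] [C0Manifold X] (φ : ∀ i, F i → X) : Prop where
  isEmbedding : ∀ i, Topology.IsEmbedding (φ i)
  range_subset : ∀ i, Set.range (φ i) ⊆ C0Manifold.boundary X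
  isOpen_interior : ∀ i, ∃ U : Set X, IsOpen U ∧
    φ i '' C0Manifold.interior (F i) = U ∩ C0Manifold.boundary X
  disjoint : ∀ i j, i ≠ j →
    Disjoint (φ i '' C0Manifold.interior (F i)) (φ j '' C0Manifold.interior (F j))
  closure_eq : closure (⋃ i, φ i '' C0Manifold.interior (F i)) = C0Manifold.boundary X

/-- The homeomorphism `H^m × H^n ≃ H^{m+n}` which on the two normal coordinates is
`[0,∞)² ≃ [0,∞) × ℝ`, `(a, b) ↦ (min a b, a - b)`. -/
def HalfSpace.prodHomeo (m n : ℕ) : HalfSpace m × HalfSpace n ≃ₜ HalfSpace (m + n) where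
  toFun p := ⟨Fin.addCases
      (fun a => if h : a.val = 0 ∧ 0 < n then min (p.1.1 a) (p.2.1 ⟨0, h.2⟩) else p.1.1 a)
      (fun b => if h : b.val = 0 ∧ 0 < m then p.1.1 ⟨0, h.2⟩ - p.2.1 b else p.2.1 b), by
    intro i
    refine Fin.addCases (fun a ha => ?_) (fun b hb => ?_) i
    · have ha' : a.val = 0 := by simpa using ha
      simp only [Fin.addCases_left]
      split_ifs with h
      · exact le_min (p.1.2 a ha') (p.2.2 _ rfl)
      · exact p.1.2 a ha'
    · simp only [Fin.val_natAdd] at hb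
      simp only [Fin.addCases_right]
      rw [dif_neg (by omega)]
      exact p.2.2 b (by omega)⟩
  invFun z :=
    (⟨fun a => if h : a.val = 0 ∧ 0 < n
        then z.1 (Fin.castAdd n a) + max (z.1 (Fin.natAdd m ⟨0, h.2⟩)) 0
        else z.1 (Fin.castAdd n a), by
      intro a ha
      have h0 : 0 ≤ z.1 (Fin.castAdd n a) := z.2 _ (by simpa using ha)
      beta_reduce
      split_ifs with h
      · positivity
      · exact h0⟩,
     ⟨fun b => if h : b.val = 0 ∧ 0 < m
        then z.1 (Fin.castAdd n ⟨0, h.2⟩) + max (-(z.1 (Fin.natAdd m b))) 0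
        else z.1 (Fin.natAdd m b), by
      intro b hb
      beta_reduce
      split_ifs with h
      · have h0 : 0 ≤ z.1 (Fin.castAdd n ⟨0, h.2⟩) := z.2 _ (by simp)
        positivity
      · refine z.2 _ ?_
        simp only [Fin.val_natAdd]
        omega⟩)
  left_inv := by
    rintro ⟨x, y⟩
    refine Prod.ext (Subtype.ext (funext fun a => ?_)) (Subtype.ext (funext fun b => ?_))
    · simp only [Fin.addCases_left, Fin.addCases_right]
      by_cases h : a.val = 0 ∧ 0 < n
      · have ha : a = ⟨0, by omega⟩ := Fin.ext h.1
        rw [dif_pos h, dif_pos h, dif_pos ⟨trivial, by omega⟩, ← ha]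
        rcases le_total (x.1 a) (y.1 ⟨0, h.2⟩) with h' | h'
        · rw [min_eq_left h', max_eq_right (by linarith)]; ring
        · rw [min_eq_right h', max_eq_left (by linarith)]; ring
      · rw [dif_neg h, dif_neg h]
    · simp only [Fin.addCases_left, Fin.addCases_right]
      by_cases h : b.val = 0 ∧ 0 < m
      · have hb : b = ⟨0, by omega⟩ := Fin.ext h.1
        rw [dif_pos h, dif_pos h, dif_pos ⟨trivial, by omega⟩, ← hb]
        rcases le_total (x.1 ⟨0, h.2⟩) (y.1 b) with h' | h'
        · rw [min_eq_left h', max_eq_left (by linarith)]; ring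
        · rw [min_eq_right h', max_eq_right (by linarith)]; ring
      · rw [dif_neg h, dif_neg h]
  right_inv := by
    intro z
    refine Subtype.ext (funext fun i => ?_)
    refine Fin.addCases (fun a => ?_) (fun b => ?_) i
    · simp only [Fin.addCases_left]
      by_cases h : a.val = 0 ∧ 0 < n
      · have ha : a = ⟨0, by omega⟩ := Fin.ext h.1
        rw [dif_pos h, dif_pos h, dif_pos ⟨trivial, by omega⟩, ← ha]
        rcases le_total (z.1 (Fin.natAdd m ⟨0, h.2⟩)) 0 with h' | h'
        · rw [max_eq_right h', max_eq_left (by linarith), min_eq_left (by linarith)]; ring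
        · rw [max_eq_left h', max_eq_right (by linarith), min_eq_right (by linarith)]; ring
      · rw [dif_neg h, dif_neg h]
    · simp only [Fin.addCases_right]
      by_cases h : b.val = 0 ∧ 0 < m
      · have hb : b = ⟨0, by omega⟩ := Fin.ext h.1
        rw [dif_pos h, dif_pos h, dif_pos ⟨trivial, by omega⟩, ← hb]
        rcases le_total (z.1 (Fin.natAdd m b)) 0 with h' | h'
        · rw [max_eq_right h', max_eq_left (by linarith)]; ring
        · rw [max_eq_left h', max_eq_right (by linarith)]; ring
      · rw [dif_neg h, dif_neg h]
  continuous_toFun := by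
    refine Continuous.subtype_mk (continuous_pi fun i => ?_) _
    have hx : ∀ a, Continuous fun p : HalfSpace m × HalfSpace n => p.1.1 a := fun a =>
      (continuous_apply a).comp (continuous_subtype_val.comp continuous_fst)
    have hy : ∀ b, Continuous fun p : HalfSpace m × HalfSpace n => p.2.1 b := fun b =>
      (continuous_apply b).comp (continuous_subtype_val.comp continuous_snd)
    refine Fin.addCases (fun a => ?_) (fun b => ?_) i
    · simp only [Fin.addCases_left]
      split_ifs with h
      · exact (hx _).min (hy _)
      · exact hx _
    · simp only [Fin.addCases_right]
      split_ifs with h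
      · exact (hx _).sub (hy _)
      · exact hy _
  continuous_invFun := by
    have hz : ∀ i, Continuous fun z : HalfSpace (m + n) => z.1 i := fun i =>
      (continuous_apply i).comp continuous_subtype_val
    refine Continuous.prodMk (Continuous.subtype_mk (continuous_pi fun a => ?_) _)
      (Continuous.subtype_mk (continuous_pi fun b => ?_) _)
    · split_ifs with h
      · exact (hz _).add ((hz _).max continuous_const)
      · exact hz _
    · split_ifs with h
      · exact (hz _).add ((hz _).neg.max continuous_const)
      · exact hz _

/-- An open subset of a product of `C⁰`-manifolds with boundary is a `C⁰`-manifold with boundary,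
with `dim (x, y) = dim x + dim y`. -/
abbrev C0Manifold.ofOpenProd {X Y : Type*} [TopologicalSpace X] [TopologicalSpace Y]
    [C0Manifold X] [C0Manifold Y] (S : Set (X × Y)) (hS : IsOpen S) : C0Manifold S where
  t2 := by
    have := C0Manifold.t2 (X := X)
    have := C0Manifold.t2 (X := Y)
    infer_instance
  secondCountable := by
    have := C0Manifold.secondCountable (X := X)
    have := C0Manifold.secondCountable (X := Y)
    infer_instance
  dim := fun p => C0Manifold.dim p.1.1 + C0Manifold.dim p.1.2
  isLocallyConstant_dim := by
    have h1 := (C0Manifold.isLocallyConstant_dim (X := X)).comp_continuous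
      (continuous_fst.comp (continuous_subtype_val (p := fun p => p ∈ S)))
    have h2 := (C0Manifold.isLocallyConstant_dim (X := Y)).comp_continuous
      (continuous_snd.comp (continuous_subtype_val (p := fun p => p ∈ S)))
    exact h1.add h2
  dim_bounded := by
    obtain ⟨N, hN⟩ := C0Manifold.dim_bounded (X := X)
    obtain ⟨M, hM⟩ := C0Manifold.dim_bounded (X := Y)
    exact ⟨N + M, fun p => add_le_add (hN _) (hM _)⟩
  exists_chart := by
    intro p
    obtain ⟨e, he⟩ := C0Manifold.exists_chart p.1.1
    obtain ⟨f, hf⟩ := C0Manifold.exists_chart p.1.2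
    let U : TopologicalSpace.Opens (X × Y) := ⟨S, hS⟩
    exact ⟨(((e.prod f).trans (HalfSpace.prodHomeo _ _).toOpenPartialHomeomorph).subtypeRestr
      (s := U) ⟨p⟩), by simpa [OpenPartialHomeomorph.subtypeRestr_source] using ⟨he, hf⟩⟩

/-! ### Associahedra -/

/-- Triples `i < j < k` in `{0, …, n-1}`. -/
abbrev Triple (n : ℕ) : Type :=
  {p : Fin n × Fin n × Fin n // p.1 < p.2.1 ∧ p.2.1 < p.2.2}

/-- The ratios `(x_j - x_i) / (x_k - x_i)`, `i < j < k`, of a configuration of `n` points on `ℝ`.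
For strictly increasing configurations they are coordinates on the moduli space of `n` ordered
points on `ℝ` modulo affine maps, i.e. of disks with `n + 1` boundary marked points. -/
def ratios {n : ℕ} (x : Fin n → ℝ) : Triple n → ℝ :=
  fun p => (x p.1.2.1 - x p.1.1) / (x p.1.2.2 - x p.1.1)

/-- The set underlying the associahedron `K_n`. -/
def associahedronSet (n : ℕ) : Set (Triple n → ℝ) :=
  closure (ratios '' {x : Fin n → ℝ | StrictMono x})

/-- The `(n-2)`-dimensional associahedron `K_n`, realized as the compactified moduli space of
configurations `x_1 < ⋯ < x_n` on `ℝ` modulo affine maps (the compactification by all ratios of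
distances). `K_0`, `K_1` and `K_2` are points. -/
abbrev Associahedron (n : ℕ) : Type := associahedronSet n

/-- The map `{0, …, n-1} → {0, …, m-1}`, `m + t = n + 1`, that collapses the block
`{s, …, s+t-1}` to `s` (if `t = 0`, it skips `s`). -/
def collapse {m t n : ℕ} (s : ℕ) (h : m + t = n + 1) (hs : s < m) (i : Fin n) : Fin m :=
  if i.val < s then ⟨min i.val s, by omega⟩
  else if i.val < s + t then ⟨s, hs⟩
  else ⟨i.val + 1 - t, by omega⟩

theorem collapse_val {m t n : ℕ} (s : ℕ) (h : m + t = n + 1) (hs : s < m) (i : Fin n) :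
    (collapse s h hs i).val =
      if i.val < s then i.val else if i.val < s + t then s else i.val + 1 - t := by
  unfold collapse
  split_ifs <;> (simp; try omega)

theorem collapse_mono {m t n : ℕ} (s : ℕ) (h : m + t = n + 1) (hs : s < m) {i j : Fin n}
    (hij : i < j) : collapse s h hs i ≤ collapse s h hs j := by
  rw [Fin.le_def, collapse_val, collapse_val]
  have : i.val < j.val := hij
  split_ifs <;> omega

/-- The operadic composition on the coordinates: the block `{s, …, s+t-1}` carries an
infinitesimally small copy of the configuration `r''`, placed at the point `s` of `r'`. -/
def compFun {m t n : ℕ} (s : ℕ) (h : m + t = n + 1) (hs : s < m)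
    (r' : Triple m → ℝ) (r'' : Triple t → ℝ) : Triple n → ℝ := fun p =>
  if hb : s ≤ p.1.1.val ∧ p.1.2.2.val < s + t then
    r'' ⟨(⟨p.1.1.val - s, by have h1 := p.2.1; have h2 := p.2.2; simp only [Fin.lt_def] at h1 h2; omega⟩,
          ⟨p.1.2.1.val - s, by have h1 := p.2.1; have h2 := p.2.2; simp only [Fin.lt_def] at h1 h2; omega⟩,
          ⟨p.1.2.2.val - s, by have h1 := p.2.1; have h2 := p.2.2; simp only [Fin.lt_def] at h1 h2; omega⟩),
        by
          have h1 := p.2.1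
          have h2 := p.2.2
          simp only [Fin.lt_def] at h1 h2 ⊢
          omega⟩
  else if h1 : collapse s h hs p.1.1 = collapse s h hs p.1.2.1 then 0
  else if h2 : collapse s h hs p.1.2.1 = collapse s h hs p.1.2.2 then 1
  else r' ⟨(collapse s h hs p.1.1, collapse s h hs p.1.2.1, collapse s h hs p.1.2.2),
    lt_of_le_of_ne (collapse_mono s h hs p.2.1) h1,
    lt_of_le_of_ne (collapse_mono s h hs p.2.2) h2⟩

theorem compFun_ratios_mem {m t n : ℕ} (s : ℕ) (h : m + t = n + 1) (hs : s < m)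
    {x : Fin m → ℝ} (hx : StrictMono x) {y : Fin t → ℝ} (hy : StrictMono y) :
    compFun s h hs (ratios x) (ratios y) ∈ associahedronSet n := by
  classical
  let b : Fin n → ℝ := fun i =>
    if hb : s ≤ i.val ∧ i.val < s + t then y ⟨i.val - s, by omega⟩ else 0
  let z : ℝ → Fin n → ℝ := fun ε i => x (collapse s h hs i) + ε * b i
  have hz : ∀ i, Filter.Tendsto (fun ε => z ε i) (nhdsWithin 0 (Set.Ioi 0))
      (nhds (x (collapse s h hs i))) := fun i => by
    have hc : Continuous fun ε : ℝ => z ε i := by fun_prop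
    have := (hc.tendsto 0).mono_left (nhdsWithin_le_nhds (s := Set.Ioi 0))
    simpa [z] using this
  have hblock : ∀ i j : Fin n, i < j → collapse s h hs i = collapse s h hs j →
      (s ≤ i.val ∧ i.val < s + t) ∧ (s ≤ j.val ∧ j.val < s + t) := by
    intro i j hij hc
    have hc' := congrArg Fin.val hc
    rw [collapse_val, collapse_val] at hc'
    have : i.val < j.val := hij
    split_ifs at hc' <;> omega
  have hmono : ∀ᶠ ε in nhdsWithin (0 : ℝ) (Set.Ioi 0), StrictMono (z ε) := by
    have : ∀ᶠ ε in nhdsWithin (0 : ℝ) (Set.Ioi 0), ∀ i j : Fin n, i < j → z ε i < z ε j := by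
      refine Filter.eventually_all.2 fun i => Filter.eventually_all.2 fun j => ?_
      by_cases hij : i < j
      swap
      · exact Filter.Eventually.of_forall fun _ h' => absurd h' hij
      rcases (collapse_mono s h hs hij).lt_or_eq with hlt | heq
      · filter_upwards [(hz i).eventually_lt (hz j) (hx hlt)] with ε hε _ using hε
      · filter_upwards [self_mem_nhdsWithin] with ε hε _
        obtain ⟨hi, hj⟩ := hblock i j hij heq
        have : i.val < j.val := hij
        have hb : b i < b j := by
          simp only [b, dif_pos hi, dif_pos hj]
          exact hy (by simp only [Fin.lt_def]; omega)
        have := mul_lt_mul_of_pos_left hb (show (0 : ℝ) < ε from hε)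
        simp only [z, heq]
        linarith
    filter_upwards [this] with ε hε i j hij using hε i j hij
  refine mem_closure_of_tendsto (f := fun ε => ratios (z ε))
    (b := nhdsWithin (0 : ℝ) (Set.Ioi 0)) ?_
    (by filter_upwards [hmono] with ε hε using ⟨z ε, hε, rfl⟩)
  refine tendsto_pi_nhds.2 fun p => ?_
  obtain ⟨⟨i, j, k⟩, hij, hjk⟩ := p
  have hij' : i.val < j.val := hij
  have hjk' : j.val < k.val := hjk
  simp only [compFun]
  by_cases hb : s ≤ i.val ∧ k.val < s + t
  · rw [dif_pos hb]
    refine (tendsto_const_nhds).congr' ?_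
    filter_upwards [self_mem_nhdsWithin] with ε hε
    have hε' : ε ≠ 0 := ne_of_gt hε
    have hc : ∀ l : Fin n, i ≤ l → l ≤ k → collapse s h hs l = ⟨s, hs⟩ := by
      intro l h1 h2
      rw [Fin.le_def] at h1 h2
      apply Fin.ext
      rw [collapse_val]
      split_ifs <;> simp <;> omega
    have hbl : ∀ l : Fin n, (h1 : i ≤ l) → (h2 : l ≤ k) →
        b l = y ⟨l.val - s, by rw [Fin.le_def] at h1 h2; omega⟩ := by
      intro l h1 h2
      rw [Fin.le_def] at h1 h2
      exact dif_pos (by omega)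
    simp only [ratios, z, hc i le_rfl (hij.trans hjk).le, hc j hij.le hjk.le,
      hc k (hij.trans hjk).le le_rfl, hbl i le_rfl (hij.trans hjk).le, hbl j hij.le hjk.le,
      hbl k (hij.trans hjk).le le_rfl]
    rw [add_sub_add_left_eq_sub, add_sub_add_left_eq_sub, ← mul_sub, ← mul_sub,
      mul_div_mul_left _ _ hε']
  · rw [dif_neg hb]
    have hik : collapse s h hs i < collapse s h hs k := by
      refine lt_of_le_of_ne (collapse_mono s h hs (hij.trans hjk)) fun he => hb ?_
      obtain ⟨h1, h2⟩ := hblock i k (hij.trans hjk) he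
      exact ⟨h1.1, h2.2⟩
    have hne : x (collapse s h hs k) - x (collapse s h hs i) ≠ 0 := (sub_pos.2 (hx hik)).ne'
    have hlim := ((hz j).sub (hz i)).div ((hz k).sub (hz i)) hne
    split_ifs with h1 h2
    · rw [← h1, sub_self, zero_div] at hlim
      exact hlim
    · rw [h2, div_self hne] at hlim
      exact hlim
    · exact hlim

theorem compFun_mem {m t n : ℕ} (s : ℕ) (h : m + t = n + 1) (hs : s < m)
    {r' : Triple m → ℝ} (hr' : r' ∈ associahedronSet m)
    {r'' : Triple t → ℝ} (hr'' : r'' ∈ associahedronSet t) :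
    compFun s h hs r' r'' ∈ associahedronSet n := by
  have hcont : Continuous (Function.uncurry (compFun (n := n) s h hs)) := by
    refine continuous_pi fun p => ?_
    simp only [Function.uncurry, compFun]
    split_ifs
    · exact (continuous_apply _).comp continuous_snd
    · exact continuous_const
    · exact continuous_const
    · exact (continuous_apply _).comp continuous_fst
  have := map_mem_closure₂ hcont hr' hr'' (u := associahedronSet n) (by
    rintro _ ⟨x, hx, rfl⟩ _ ⟨y, hy, rfl⟩
    exact compFun_ratios_mem s h hs hx hy)
  rwa [associahedronSet, closure_closure] at this

/-- The operadic composition `σ_{s+1} : K_m × K_t → K_n`, `m + t = n + 1`, of associahedra, at the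
input `s + 1` (counted from 1). For `t = 0` it is the map that forgets the point `s + 1`. -/
def Associahedron.comp {m t n : ℕ} (s : ℕ) (h : m + t = n + 1) (hs : s < m)
    (r' : Associahedron m) (r'' : Associahedron t) : Associahedron n :=
  ⟨compFun s h hs r'.1 r''.1, compFun_mem s h hs r'.2 r''.2⟩

/-! ### Tuples of objects -/

/-- Transport in a family `M a b` along equalities of the indices. -/
def castHom {Ob : Type u} (M : Ob → Ob → Type v) {a a' b b' : Ob} (ha : a = a') (hb : b = b')
    (x : M a b) : M a' b' :=
  cast (congrArg₂ M ha hb) x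

/-- `Insertion s L' L'' L` says that, for `L = (L^0, …, L^n)` and `s + t ≤ n`,
`L' = (L^0, …, L^s, L^{s+t}, …, L^n)` and `L'' = (L^s, …, L^{s+t})`.
For given `L`, `s`, `t` there is exactly one such pair of tuples. -/
structure Insertion {Ob : Type u} {m t n : ℕ} (s : ℕ) (L' : Fin (m + 1) → Ob)
    (L'' : Fin (t + 1) → Ob) (L : Fin (n + 1) → Ob) : Prop where
  len : m + t = n + 1
  lt : s < m
  outer_left : ∀ (i : ℕ) (hi : i ≤ s), L' ⟨i, by omega⟩ = L ⟨i, by omega⟩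
  outer_right : ∀ (i : ℕ) (_ : s ≤ i) (hi : i < m), L' ⟨i + 1, by omega⟩ = L ⟨i + t, by omega⟩
  inner : ∀ (i : ℕ) (hi : i ≤ t), L'' ⟨i, by omega⟩ = L ⟨s + i, by omega⟩

/-- The tuple `(L^0, …, L^s, L^{s+t}, …, L^n)`. -/
def outer {Ob : Type u} {n : ℕ} (L : Fin (n + 1) → Ob) (s t : ℕ) (h : s + t ≤ n) :
    Fin (n - t + 1 + 1) → Ob :=
  fun i => if hi : i.val ≤ s then L ⟨i.val, by omega⟩ else L ⟨i.val - 1 + t, by omega⟩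

/-- The tuple `(L^s, …, L^{s+t})`. -/
def inner {Ob : Type u} {n : ℕ} (L : Fin (n + 1) → Ob) (s t : ℕ) (h : s + t ≤ n) :
    Fin (t + 1) → Ob :=
  fun i => L ⟨s + i.val, by omega⟩

theorem outer_left {Ob : Type u} {n : ℕ} (L : Fin (n + 1) → Ob) (s t : ℕ) (h : s + t ≤ n)
    (i : ℕ) (hi : i ≤ s) : outer L s t h ⟨i, by omega⟩ = L ⟨i, by omega⟩ :=
  dif_pos hi

theorem outer_right {Ob : Type u} {n : ℕ} (L : Fin (n + 1) → Ob) (s t : ℕ) (h : s + t ≤ n)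
    (i : ℕ) (hs : s ≤ i) (hi : i < n - t + 1) :
    outer L s t h ⟨i + 1, by omega⟩ = L ⟨i + t, by omega⟩ :=
  dif_neg (by simp only; omega)

theorem insertion_outer_inner {Ob : Type u} {n : ℕ} (L : Fin (n + 1) → Ob) (s t : ℕ)
    (h : s + t ≤ n) : Insertion s (outer L s t h) (inner L s t h) L where
  len := by omega
  lt := by omega
  outer_left := outer_left L s t h
  outer_right := outer_right L s t h
  inner := fun _ _ => rfl

theorem Insertion.outer_zero {Ob : Type u} {m t n s : ℕ} {L' : Fin (m + 1) → Ob}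
    {L'' : Fin (t + 1) → Ob} {L : Fin (n + 1) → Ob} (h : Insertion s L' L'' L) :
    L' 0 = L 0 :=
  h.outer_left 0 (Nat.zero_le s)

theorem Insertion.outer_last {Ob : Type u} {m t n s : ℕ} {L' : Fin (m + 1) → Ob}
    {L'' : Fin (t + 1) → Ob} {L : Fin (n + 1) → Ob} (h : Insertion s L' L'' L) :
    L' (Fin.last m) = L (Fin.last n) := by
  obtain ⟨k, rfl⟩ : ∃ k, m = k + 1 := ⟨m - 1, by have := h.lt; omega⟩
  have h1 := h.outer_right k (by have := h.lt; omega) (by omega)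
  have h2 : (⟨k + t, by have := h.len; omega⟩ : Fin (n + 1)) = Fin.last n :=
    Fin.ext (by have := h.len; simp only [Fin.val_last]; omega)
  rw [← h2]
  exact h1

/-- The pairs `(s, t)` with `s, t ≥ 0` and `s + t ≤ n`. -/
abbrev Slot (n : ℕ) : Type := {p : Fin (n + 1) × Fin (n + 1) // p.1.val + p.2.val ≤ n}

/-! ### Regularized `A_∞`-flow categories -/

/-- The spaces and maps of a regularized `A_∞`-flow category in the `(C⁰, Morse)`-framework,
without the boundary decomposition maps. The tuple `(L^0, …, L^n)` is `L : Fin (n + 1) → Ob`, and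
`α k` is the evaluation map `α^{k+1}`. The finite sets `Mor` are discrete, so continuous maps to
them are locally constant maps. -/
structure PreFlowCategory where
  Ob : Type u
  Mor : Ob → Ob → Type v
  finite_mor : ∀ a b, Finite (Mor a b)
  X : {n : ℕ} → (Fin (n + 1) → Ob) → Type w
  topX : ∀ {n : ℕ} (L : Fin (n + 1) → Ob), TopologicalSpace (X L)
  mfdX : ∀ {n : ℕ} (L : Fin (n + 1) → Ob), C0Manifold (X L)
  energy : ∀ {n : ℕ} {L : Fin (n + 1) → Ob}, X L → ℝ
  isLocallyConstant_energy : ∀ {n : ℕ} (L : Fin (n + 1) → Ob),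
    IsLocallyConstant (energy (L := L))
  isCompact_sublevel : ∀ {n : ℕ} (L : Fin (n + 1) → Ob) (E : ℝ),
    IsCompact {χ : X L | energy χ ≤ E}
  α : ∀ {n : ℕ} {L : Fin (n + 1) → Ob} (k : Fin n), X L → Mor (L k.castSucc) (L k.succ)
  isLocallyConstant_α : ∀ {n : ℕ} (L : Fin (n + 1) → Ob) (k : Fin n),
    IsLocallyConstant (α (L := L) k)
  β : ∀ {n : ℕ} {L : Fin (n + 1) → Ob}, X L → Mor (L 0) (L (Fin.last n))
  isLocallyConstant_β : ∀ {n : ℕ} (L : Fin (n + 1) → Ob), IsLocallyConstant (β (L := L))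
  p : ∀ {n : ℕ} {L : Fin (n + 1) → Ob}, X L → Associahedron n
  continuous_p : ∀ {n : ℕ} (L : Fin (n + 1) → Ob), Continuous (p (L := L))

attribute [instance] PreFlowCategory.finite_mor PreFlowCategory.topX PreFlowCategory.mfdX

namespace PreFlowCategory

variable (C : PreFlowCategory.{u, v, w}) {m t n s : ℕ} {L' : Fin (m + 1) → C.Ob}
  {L'' : Fin (t + 1) → C.Ob} {L : Fin (n + 1) → C.Ob}

/-- `α^{s+1}(χ')` as an element of `Mor(L^s, L^{s+t})`. -/
def slotα (h : Insertion s L' L'' L) (χ' : C.X L') :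
    C.Mor (L ⟨s, by have := h.len; have := h.lt; omega⟩)
      (L ⟨s + t, by have := h.len; have := h.lt; omega⟩) :=
  castHom C.Mor (h.outer_left s le_rfl) (h.outer_right s le_rfl h.lt) (C.α ⟨s, h.lt⟩ χ')

/-- `β(χ'')` as an element of `Mor(L^s, L^{s+t})`. -/
def slotβ (h : Insertion s L' L'' L) (χ'' : C.X L'') :
    C.Mor (L ⟨s, by have := h.len; have := h.lt; omega⟩)
      (L ⟨s + t, by have := h.len; have := h.lt; omega⟩) :=
  castHom C.Mor (h.inner 0 (Nat.zero_le t)) (h.inner t le_rfl) (C.β χ'')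

/-- The fiber product of `X(L')` and `X(L'')` over `α^{s+1}` and `β`. -/
def fiberProduct (h : Insertion s L' L'' L) : Set (C.X L' × C.X L'') :=
  {q | C.slotα h q.1 = C.slotβ h q.2}

theorem isOpen_fiberProduct (h : Insertion s L' L'' L) : IsOpen (C.fiberProduct h) := by
  have h1 : IsLocallyConstant fun q : C.X L' × C.X L'' => C.slotα h q.1 :=
    ((C.isLocallyConstant_α L' ⟨s, h.lt⟩).comp (castHom C.Mor _ _)).comp_continuous continuous_fst
  have h2 : IsLocallyConstant fun q : C.X L' × C.X L'' => C.slotβ h q.2 :=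
    ((C.isLocallyConstant_β L'').comp (castHom C.Mor _ _)).comp_continuous continuous_snd
  exact (h1.prodMk h2) {r | r.1 = r.2}

instance instC0ManifoldFiberProduct (h : Insertion s L' L'' L) : C0Manifold (C.fiberProduct h) :=
  C0Manifold.ofOpenProd _ (C.isOpen_fiberProduct h)

/-- The maps `φ s t`, `s + t ≤ n`, defined on the fiber products of `X(L^0, …, L^s, L^{s+t}, …, L^n)`
and `X(L^s, …, L^{s+t})`, form a system of boundary faces for `X(L)`. -/
def IsFaceSystem (L : Fin (n + 1) → C.Ob)
    (φ : ∀ st : Slot n,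
      C.fiberProduct (insertion_outer_inner L st.1.1.val st.1.2.val st.2) → C.X L) : Prop :=
  IsBoundaryFaceSystem φ

end PreFlowCategory

/-- A regularized `A_∞`-flow category in the `(C⁰, Morse)`-framework. -/
structure FlowCategory extends PreFlowCategory.{u, v, w} where
  /-- The boundary decomposition maps `φ^{s,t}`. -/
  φ : ∀ {m t n s : ℕ} {L' : Fin (m + 1) → Ob} {L'' : Fin (t + 1) → Ob} {L : Fin (n + 1) → Ob}
    (h : Insertion s L' L'' L), toPreFlowCategory.fiberProduct h → X L
  isEmbedding_φ : ∀ {m t n s : ℕ} {L' : Fin (m + 1) → Ob} {L'' : Fin (t + 1) → Ob}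
    {L : Fin (n + 1) → Ob} (h : Insertion s L' L'' L), Topology.IsEmbedding (φ h)
  /-- `φ^{s,t}` covers the operadic composition `σ_{s+1}` of associahedra. -/
  p_φ : ∀ {m t n s : ℕ} {L' : Fin (m + 1) → Ob} {L'' : Fin (t + 1) → Ob} {L : Fin (n + 1) → Ob}
    (h : Insertion s L' L'' L) (q : toPreFlowCategory.fiberProduct h),
    p (φ h q) = Associahedron.comp s h.len h.lt (p q.1.1) (p q.1.2)
  /-- Compatibility with `β`. -/
  β_φ : ∀ {m t n s : ℕ} {L' : Fin (m + 1) → Ob} {L'' : Fin (t + 1) → Ob} {L : Fin (n + 1) → Ob}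
    (h : Insertion s L' L'' L) (q : toPreFlowCategory.fiberProduct h),
    β (φ h q) = castHom Mor h.outer_zero h.outer_last (β q.1.1)
  /-- Compatibility with `α^k` for `k ≤ s` (here `k` is counted from `0`). -/
  α_φ_left : ∀ {m t n s : ℕ} {L' : Fin (m + 1) → Ob} {L'' : Fin (t + 1) → Ob}
    {L : Fin (n + 1) → Ob} (h : Insertion s L' L'' L) (q : toPreFlowCategory.fiberProduct h)
    (k : ℕ) (hk : k < s),
    α ⟨k, by have := h.len; have := h.lt; omega⟩ (φ h q) =
      castHom Mor (h.outer_left k hk.le) (h.outer_left (k + 1) hk)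
        (α ⟨k, by have := h.lt; omega⟩ q.1.1)
  /-- Compatibility with `α^k` for `s + 1 ≤ k ≤ s + t`. -/
  α_φ_mid : ∀ {m t n s : ℕ} {L' : Fin (m + 1) → Ob} {L'' : Fin (t + 1) → Ob}
    {L : Fin (n + 1) → Ob} (h : Insertion s L' L'' L) (q : toPreFlowCategory.fiberProduct h)
    (k : ℕ) (hk : k < t),
    α ⟨s + k, by have := h.len; have := h.lt; omega⟩ (φ h q) =
      castHom Mor (h.inner k hk.le) (h.inner (k + 1) hk) (α ⟨k, hk⟩ q.1.2)
  /-- Compatibility with `α^k` for `k ≥ s + t + 1`. -/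
  α_φ_right : ∀ {m t n s : ℕ} {L' : Fin (m + 1) → Ob} {L'' : Fin (t + 1) → Ob}
    {L : Fin (n + 1) → Ob} (h : Insertion s L' L'' L) (q : toPreFlowCategory.fiberProduct h)
    (k : ℕ) (hs : s ≤ k) (hk : k + 1 < m),
    α ⟨k + t, by have := h.len; omega⟩ (φ h q) =
      castHom Mor (h.outer_right k hs (by omega))
        ((h.outer_right (k + 1) (by omega) hk).trans
          (congrArg L (Fin.ext (Nat.add_right_comm k 1 t))))
        (α ⟨k + 1, hk⟩ q.1.1)
  /-- Additivity of the energy. -/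
  energy_φ : ∀ {m t n s : ℕ} {L' : Fin (m + 1) → Ob} {L'' : Fin (t + 1) → Ob}
    {L : Fin (n + 1) → Ob} (h : Insertion s L' L'' L) (q : toPreFlowCategory.fiberProduct h),
    energy (φ h q) = energy q.1.1 + energy q.1.2
  /-- The maps `φ^{s,t}` with `s + t ≤ n` form a system of boundary faces for `X(L)`. -/
  boundaryFaces : ∀ {n : ℕ} (L : Fin (n + 1) → Ob),
    toPreFlowCategory.IsFaceSystem L fun st => φ (insertion_outer_inner L st.1.1.val st.1.2.val st.2)
  /-- Associativity for an insertion within an insertion. (The last two matching conditions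
  follow from the first two, by the compatibility with the evaluation maps.) -/
  assoc_nested : ∀ {n₁ n₂ n₃ n₁₂ n₂₃ n s s' : ℕ} {L₁ : Fin (n₁ + 1) → Ob}
    {L₂ : Fin (n₂ + 1) → Ob} {L₃ : Fin (n₃ + 1) → Ob} {L₁₂ : Fin (n₁₂ + 1) → Ob}
    {L₂₃ : Fin (n₂₃ + 1) → Ob} {L : Fin (n + 1) → Ob}
    (h₁₂ : Insertion s L₁ L₂ L₁₂) (h₂₃ : Insertion s' L₂ L₃ L₂₃)
    (h : Insertion s L₁ L₂₃ L) (h' : Insertion (s + s') L₁₂ L₃ L)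
    (χ₁ : X L₁) (χ₂ : X L₂) (χ₃ : X L₃)
    (q₁₂ : (χ₁, χ₂) ∈ toPreFlowCategory.fiberProduct h₁₂)
    (q₂₃ : (χ₂, χ₃) ∈ toPreFlowCategory.fiberProduct h₂₃)
    (q : (χ₁, φ h₂₃ ⟨(χ₂, χ₃), q₂₃⟩) ∈ toPreFlowCategory.fiberProduct h)
    (q' : (φ h₁₂ ⟨(χ₁, χ₂), q₁₂⟩, χ₃) ∈ toPreFlowCategory.fiberProduct h'),
    φ h ⟨(χ₁, φ h₂₃ ⟨(χ₂, χ₃), q₂₃⟩), q⟩ = φ h' ⟨(φ h₁₂ ⟨(χ₁, χ₂), q₁₂⟩, χ₃), q'⟩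
  /-- Associativity for two independent insertions, of `L₁` (of length `n₁`) at position `s` and of
  `L₃` further to the right. -/
  assoc_parallel : ∀ {n₁ n₂ n₃ n₁₂ n₂₃ n s s' : ℕ} {L₁ : Fin (n₁ + 1) → Ob}
    {L₂ : Fin (n₂ + 1) → Ob} {L₃ : Fin (n₃ + 1) → Ob} {L₁₂ : Fin (n₁₂ + 1) → Ob}
    {L₂₃ : Fin (n₂₃ + 1) → Ob} {L : Fin (n + 1) → Ob}
    (h₁₂ : Insertion s L₂ L₁ L₁₂) (h₂₃ : Insertion (s + s' + 1) L₂ L₃ L₂₃)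
    (h : Insertion s L₂₃ L₁ L) (h' : Insertion (s + n₁ + s') L₁₂ L₃ L)
    (χ₁ : X L₁) (χ₂ : X L₂) (χ₃ : X L₃)
    (q₁₂ : (χ₂, χ₁) ∈ toPreFlowCategory.fiberProduct h₁₂)
    (q₂₃ : (χ₂, χ₃) ∈ toPreFlowCategory.fiberProduct h₂₃)
    (q : (φ h₂₃ ⟨(χ₂, χ₃), q₂₃⟩, χ₁) ∈ toPreFlowCategory.fiberProduct h)
    (q' : (φ h₁₂ ⟨(χ₂, χ₁), q₁₂⟩, χ₃) ∈ toPreFlowCategory.fiberProduct h'),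
    φ h ⟨(φ h₂₃ ⟨(χ₂, χ₃), q₂₃⟩, χ₁), q⟩ = φ h' ⟨(φ h₁₂ ⟨(χ₂, χ₁), q₁₂⟩, χ₃), q'⟩

/-- The set `X(L^0, …, L^n)_0 ∩ (α^1, …, α^n, β)⁻¹(p_1, …, p_n, q)`. -/
def FlowCategory.rigid (C : FlowCategory.{u, v, w}) {n : ℕ} (L : Fin (n + 1) → C.Ob)
    (p : ∀ k : Fin n, C.Mor (L k.castSucc) (L k.succ)) (q : C.Mor (L 0) (L (Fin.last n))) :
    Set (C.X L) :=
  {χ | C0Manifold.dim χ = 0 ∧ (∀ k, C.α k χ = p k) ∧ C.β χ = q}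

/-! ### Curved linear `A_∞`-categories -/

/-- The inner inputs `(x_{s+1}, …, x_{s+t})`. -/
def innerArgs {Ob : Type u} (M : Ob → Ob → Type v) {n : ℕ} (L : Fin (n + 1) → Ob)
    (x : ∀ k : Fin n, M (L k.castSucc) (L k.succ)) (s t : ℕ) (h : s + t ≤ n) :
    ∀ k : Fin t, M (inner L s t h k.castSucc) (inner L s t h k.succ) :=
  fun k => x ⟨s + k.val, by omega⟩

/-- The outer inputs `(x_1, …, x_s, y, x_{s+t+1}, …, x_n)`. -/
def outerArgs {Ob : Type u} (M : Ob → Ob → Type v) {n : ℕ} (L : Fin (n + 1) → Ob)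
    (x : ∀ k : Fin n, M (L k.castSucc) (L k.succ)) (s t : ℕ) (h : s + t ≤ n)
    (y : M (inner L s t h 0) (inner L s t h (Fin.last t))) :
    ∀ k : Fin (n - t + 1), M (outer L s t h k.castSucc) (outer L s t h k.succ) := fun k =>
  if h1 : k.val < s then
    castHom M (outer_left L s t h k.val h1.le).symm (outer_left L s t h (k.val + 1) h1).symm
      (x ⟨k.val, by omega⟩)
  else if h2 : k.val = s then
    castHom M
      ((congrArg L (Fin.ext (by simp [h2]))).trans (outer_left L s t h k.val h2.le).symm)
      ((congrArg L (Fin.ext (by simp [h2]))).trans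
        (outer_right L s t h k.val h2.ge k.isLt).symm) y
  else
    castHom M
      ((congrArg L (Fin.ext (by simp))).trans
        ((outer_right L s t h (k.val - 1) (by omega) (by omega)).symm.trans
          (congrArg (outer L s t h) (Fin.ext (by simp only [Fin.val_castSucc]; omega)))))
      ((congrArg L (Fin.ext (by simp only [Fin.val_succ]; omega))).trans
        (outer_right L s t h k.val (by omega) k.isLt).symm)
      (x ⟨k.val - 1 + t, by omega⟩)

/-- A curved `Λ`-linear `A_∞`-category (over a coefficient ring of characteristic 2) with set of
objects `Ob` and morphism modules `M a b`. -/
@[ext]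
structure LinearAInftyCategory (Λ : Type*) [CommRing Λ] [CharP Λ 2] (Ob : Type u)
    (M : Ob → Ob → Type v) [∀ a b, AddCommGroup (M a b)] [∀ a b, Module Λ (M a b)] where
  /-- The compositions `μ_n : M(L^0, L^1) ⊗ ⋯ ⊗ M(L^{n-1}, L^n) → M(L^0, L^n)`, `n ≥ 0`. -/
  μ : ∀ {n : ℕ} (L : Fin (n + 1) → Ob),
    MultilinearMap Λ (fun k : Fin n => M (L k.castSucc) (L k.succ)) (M (L 0) (L (Fin.last n)))
  /-- The `A_∞`-equations
  `∑_{s+t≤n} μ_{n-t+1}(x_1, …, x_s, μ_t(x_{s+1}, …, x_{s+t}), x_{s+t+1}, …, x_n) = 0`. -/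
  equation : ∀ {n : ℕ} (L : Fin (n + 1) → Ob) (x : ∀ k : Fin n, M (L k.castSucc) (L k.succ)),
    ∑ st : Slot n,
      castHom M (insertion_outer_inner L st.1.1.val st.1.2.val st.2).outer_zero
        (insertion_outer_inner L st.1.1.val st.1.2.val st.2).outer_last
        (μ (outer L st.1.1.val st.1.2.val st.2)
          (outerArgs M L x st.1.1.val st.1.2.val st.2
            (μ (inner L st.1.1.val st.1.2.val st.2)
              (innerArgs M L x st.1.1.val st.1.2.val st.2)))) = 0

end AInfty

end

namespace AInfty

open Set Filter Topology

/-! Fix inputs, an output and an energy `E`. Expanding the `A_∞`-expression on generators, its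
coefficient at `T^E` counts modulo 2 the pairs of rigid points that match along an intermediate
generator and have total energy `E`. By the face axioms these pairs correspond bijectively to the
boundary points of the one-dimensional part of `X(L)` with the given asymptotics and energy.
Dimension, energy and evaluations are locally constant, so this part is clopen inside a compact
sublevel set: it is a compact one-manifold, and its boundary is even. Hence every coefficient
vanishes, and multilinearity extends this to all inputs. Uniqueness holds because a Novikov count
determines its series and generators determine a multilinear map.

Evenness (`even_ncard_isEnd`) is proved without classifying one-manifolds. For a set `B` with finite
frontier, count the points where exactly one one-sided germ of `B` is full, the missing side of an
end counting as empty. These jumps add modulo 2 over disjoint unions (`jumps_union_iff`), and inside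
a single arc they are the jumps of a bounded subset of the line, which are even in number
(`even_ncard_jumpSet`). Cutting along finitely many arcs, every such `B` in a compact one-manifold
`M` has an even number of jumps, and the jumps of `M` itself are its ends.

Face systems carry no explicit dimension condition; `IsBoundaryFaceSystem.dim_eq_one_iff` recovers
it topologically. A point has dimension 0 iff it is isolated, and a boundary point has dimension 1
iff it is isolated in the boundary. `even_card_broken` combines these facts with the gluing
bijection, and `HasNovikovCount.prod` and `HasNovikovCount.sigma` translate between the products of
series and the pairs of points. -/

theorem notMem_of_compl_mem {α : Type*} {l : Filter α} [l.NeBot] {A : Set α} (h : Aᶜ ∈ l) :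
    A ∉ l := fun h' => by
  have := inter_mem h h'
  rw [compl_inter_self] at this
  exact empty_notMem l this

/-! ### Parity of the number of jumps of a subset of the real line -/

/-- The points of `ℝ` where the one-sided germs of `S` differ. -/
def jumpSet (S : Set ℝ) : Set ℝ := {t | ¬ (S ∈ 𝓝[<] t ↔ S ∈ 𝓝[>] t)}

theorem ncard_inter_Iic_eventually_right {J : Set ℝ} (hJ : J.Finite) (x : ℝ) :
    ∀ᶠ y in 𝓝[>] x, J ∩ Iic y = J ∩ Iic x := by
  have h : ∀ᶠ y in 𝓝[>] x, ∀ j ∈ J, x < j → y < j := by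
    refine (hJ.eventually_all (l := 𝓝[>] x)).2 fun j _ => ?_
    by_cases hj : x < j
    · exact (eventually_nhdsWithin_of_eventually_nhds (Iio_mem_nhds hj)).mono fun y hy _ => hy
    · exact Eventually.of_forall fun y h => absurd h hj
  filter_upwards [h, self_mem_nhdsWithin] with y hy hxy
  ext j
  simp only [mem_inter_iff, mem_Iic, mem_Ioi] at *
  refine and_congr_right fun hj => ⟨fun h => ?_, fun h => h.trans hxy.le⟩
  by_contra hc
  exact absurd (hy j hj (not_le.1 hc)) (not_lt.2 h)

theorem ncard_inter_Iic_eventually_left {J : Set ℝ} (hJ : J.Finite) (x : ℝ) :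
    ∀ᶠ y in 𝓝[<] x, J ∩ Iic y = J ∩ Iio x := by
  have h : ∀ᶠ y in 𝓝[<] x, ∀ j ∈ J, j < x → j < y := by
    refine (hJ.eventually_all (l := 𝓝[<] x)).2 fun j _ => ?_
    by_cases hj : j < x
    · exact (eventually_nhdsWithin_of_eventually_nhds (Ioi_mem_nhds hj)).mono fun y hy _ => hy
    · exact Eventually.of_forall fun y h => absurd h hj
  filter_upwards [h, self_mem_nhdsWithin] with y hy hxy
  ext j
  simp only [mem_inter_iff, mem_Iic, mem_Iio] at *
  exact and_congr_right fun hj => ⟨fun h => h.trans_lt hxy, fun h => (hy j hj h).le⟩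

/-- Modulo 2, the number of jumps up to `x` plus the indicator of a full right germ at `x` is
locally constant in `x`, since both terms change at a jump and neither changes elsewhere.
Connectedness of the line equates its value 0 to the left of `[a, b]` with its value to the right,
the total number of jumps. -/
theorem even_ncard_jumpSet {S : Set ℝ} {a b : ℝ} (hS : S ⊆ Icc a b)
    (hR : ∀ t, S ∈ 𝓝[>] t ∨ Sᶜ ∈ 𝓝[>] t) (hL : ∀ t, S ∈ 𝓝[<] t ∨ Sᶜ ∈ 𝓝[<] t)
    (hJ : (jumpSet S).Finite) : Even (jumpSet S).ncard := by
  classical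
  set J := jumpSet S with hJdef
  let g : ℝ → ZMod 2 := fun x => ((J ∩ Iic x).ncard : ZMod 2) + if S ∈ 𝓝[>] x then 1 else 0
  have hg : IsLocallyConstant g := by
    rw [IsLocallyConstant.iff_eventually_eq]
    intro x
    rw [← nhdsNE_sup_pure x, ← Iio_union_Ioi, nhdsWithin_union, eventually_sup, eventually_sup]
    refine ⟨⟨?_, ?_⟩, by simp⟩
    -- The value at `x` is rewritten in terms of the left germ: at a jump the count loses one and
    -- the indicator flips, which cancel modulo 2.
    · have hval : g x = ((J ∩ Iio x).ncard : ZMod 2) + if S ∈ 𝓝[<] x then 1 else 0 := by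
        by_cases hx : x ∈ J
        · have h1 : J ∩ Iic x = insert x (J ∩ Iio x) := by
            ext j
            simp only [mem_inter_iff, mem_Iic, mem_insert_iff, mem_Iio]
            constructor
            · rintro ⟨h1, h2⟩
              rcases h2.eq_or_lt with h | h
              · exact Or.inl h
              · exact Or.inr ⟨h1, h⟩
            · rintro (rfl | h)
              · exact ⟨hx, le_rfl⟩
              · exact ⟨h.1, h.2.le⟩
          have h2 : (J ∩ Iic x).ncard = (J ∩ Iio x).ncard + 1 := by
            rw [h1, ncard_insert_of_notMem (by simp) (hJ.subset inter_subset_left)]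
          have hx' : ¬ (S ∈ 𝓝[<] x ↔ S ∈ 𝓝[>] x) := hx
          have e2 : (1 : ZMod 2) + 1 = 0 := rfl
          simp only [g, h2]
          push_cast
          by_cases h3 : S ∈ 𝓝[<] x <;> by_cases h4 : S ∈ 𝓝[>] x <;>
            simp [h3, h4, add_assoc, e2] at hx' ⊢
        · have h1 : J ∩ Iic x = J ∩ Iio x := by
            ext j
            simp only [mem_inter_iff, mem_Iic, mem_Iio]
            refine and_congr_right fun hj => ⟨fun h => lt_of_le_of_ne h ?_, le_of_lt⟩
            rintro rfl
            exact hx hj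
          have hx' : S ∈ 𝓝[<] x ↔ S ∈ 𝓝[>] x := by
            by_contra h
            exact hx h
          simp only [g, h1, hx']
      -- `S` is full or empty on an interval to the left of `x`, so it is full or empty near every
      -- point of that interval.
      have hs : ∀ᶠ y in 𝓝[<] x, (S ∈ 𝓝[>] y ↔ S ∈ 𝓝[<] x) := by
        rcases hL x with h | h
        · filter_upwards [(eventually_eventually_nhdsWithin (s := Iio x)).2 h,
            self_mem_nhdsWithin] with y hy hyx
          have : S ∈ 𝓝 y := by
            have := hy
            rw [IsOpen.nhdsWithin_eq isOpen_Iio hyx] at this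
            exact this
          exact ⟨fun _ => h, fun _ => mem_nhdsWithin_of_mem_nhds this⟩
        · filter_upwards [(eventually_eventually_nhdsWithin (s := Iio x)).2 h,
            self_mem_nhdsWithin] with y hy hyx
          have : Sᶜ ∈ 𝓝 y := by
            have := hy
            rw [IsOpen.nhdsWithin_eq isOpen_Iio hyx] at this
            exact this
          exact ⟨fun h' => absurd h' (notMem_of_compl_mem (mem_nhdsWithin_of_mem_nhds this)),
            fun h' => absurd h' (notMem_of_compl_mem h)⟩
      filter_upwards [hs, ncard_inter_Iic_eventually_left hJ x] with y h1 h2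
      rw [hval]
      simp only [g, h1, h2]
    · have hs : ∀ᶠ y in 𝓝[>] x, (S ∈ 𝓝[>] y ↔ S ∈ 𝓝[>] x) := by
        rcases hR x with h | h
        · filter_upwards [(eventually_eventually_nhdsWithin (s := Ioi x)).2 h,
            self_mem_nhdsWithin] with y hy hyx
          have : S ∈ 𝓝 y := by
            have := hy
            rw [IsOpen.nhdsWithin_eq isOpen_Ioi hyx] at this
            exact this
          exact ⟨fun _ => h, fun _ => mem_nhdsWithin_of_mem_nhds this⟩
        · filter_upwards [(eventually_eventually_nhdsWithin (s := Ioi x)).2 h,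
            self_mem_nhdsWithin] with y hy hyx
          have : Sᶜ ∈ 𝓝 y := by
            have := hy
            rw [IsOpen.nhdsWithin_eq isOpen_Ioi hyx] at this
            exact this
          exact ⟨fun h' => absurd h' (notMem_of_compl_mem (mem_nhdsWithin_of_mem_nhds this)),
            fun h' => absurd h' (notMem_of_compl_mem h)⟩
      filter_upwards [hs, ncard_inter_Iic_eventually_right hJ x] with y h1 h2
      simp only [g, h1, h2]
  have hout : ∀ y, y ∉ Icc a b → Sᶜ ∈ 𝓝 y := fun y hy =>
    mem_of_superset (isClosed_Icc.isOpen_compl.mem_nhds hy) (compl_subset_compl.2 hS)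
  have hJsub : J ⊆ Icc a b := by
    intro j hj
    by_contra h
    exact hj ⟨fun h' => absurd h' (notMem_of_compl_mem (mem_nhdsWithin_of_mem_nhds (hout j h))),
      fun h' => absurd h' (notMem_of_compl_mem (mem_nhdsWithin_of_mem_nhds (hout j h)))⟩
  have h0 : g (a - 1) = 0 := by
    have h1 : J ∩ Iic (a - 1) = ∅ := by
      ext j
      simp only [mem_inter_iff, mem_Iic, mem_empty_iff_false, iff_false, not_and, not_le]
      intro hj
      have := (hJsub hj).1
      linarith
    have h2 : S ∉ 𝓝[>] (a - 1) :=
      notMem_of_compl_mem (mem_nhdsWithin_of_mem_nhds (hout _ fun h => by linarith [h.1]))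
    simp [g, h1, h2]
  have h1 : g (b + 1) = (J.ncard : ZMod 2) := by
    have h1 : J ∩ Iic (b + 1) = J := by
      refine inter_eq_left.2 fun j hj => ?_
      have := (hJsub hj).2
      simp only [mem_Iic]
      linarith
    have h2 : S ∉ 𝓝[>] (b + 1) :=
      notMem_of_compl_mem (mem_nhdsWithin_of_mem_nhds (hout _ fun h => by linarith [h.2]))
    simp [g, h1, h2]
  have := hg.apply_eq_of_preconnectedSpace (a - 1) (b + 1)
  rw [h0, h1] at this
  exact (ZMod.natCast_eq_zero_iff_even).1 this.symm

/-! ### Jumps of subsets of a one-dimensional manifold -/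

/-- Away from the frontier of `B` the space is the disjoint union of two open sets, the interiors of
`B` and of its complement. -/
theorem _root_.IsPreconnected.subset_or_subset_compl_of_frontier {X : Type*} [TopologicalSpace X]
    {s B : Set X} (hs : IsPreconnected s) (h : Disjoint s (frontier B)) : s ⊆ B ∨ s ⊆ Bᶜ := by
  have hcov : s ⊆ interior B ∪ interior Bᶜ := by
    intro x hx
    by_contra hc
    rw [interior_compl, mem_union, not_or] at hc
    exact disjoint_left.1 h hx ⟨not_not.1 hc.2, hc.1⟩
  have hd : Disjoint (interior B) (interior Bᶜ) :=
    disjoint_compl_right.mono interior_subset interior_subset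
  exact (hs.subset_or_subset isOpen_interior isOpen_interior hd hcov).imp
    (fun h => h.trans interior_subset) (fun h => h.trans interior_subset)

/-- `v` is an end of `X`: a punctured neighbourhood of `v` cannot be split. -/
def IsEnd {X : Type*} [TopologicalSpace X] (v : X) : Prop :=
  ∀ B : Set X, (∀ᶠ x in 𝓝[≠] v, x ∉ frontier B) → B ∈ 𝓝[≠] v ∨ Bᶜ ∈ 𝓝[≠] v

open Classical in
/-- `B` jumps at `v`: exactly one of the one-sided germs of `B` at `v` is full. -/
def Jumps {X : Type*} [TopologicalSpace X] (B : Set X) (v : X) : Prop :=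
  if IsEnd v then B ∈ 𝓝[≠] v else B ∉ 𝓝[≠] v ∧ Bᶜ ∉ 𝓝[≠] v

/-- The point `max t 0` of the half-line. -/
def HalfSpace.ray (t : ℝ) : HalfSpace 1 := ⟨fun _ => max t 0, fun _ _ => le_max_right _ _⟩

theorem HalfSpace.continuous_ray : Continuous HalfSpace.ray :=
  Continuous.subtype_mk (continuous_pi fun _ => continuous_id.max continuous_const) _

/-- The coordinate on the half-line. -/
def HalfSpace.coord (x : HalfSpace 1) : ℝ := x.1 0

theorem HalfSpace.continuous_coord : Continuous HalfSpace.coord :=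
  (continuous_apply 0).comp continuous_subtype_val

theorem HalfSpace.coord_nonneg (x : HalfSpace 1) : 0 ≤ x.coord := x.2 0 rfl

@[simp] theorem HalfSpace.ray_coord (x : HalfSpace 1) : ray x.coord = x := by
  refine Subtype.ext (funext fun i => ?_)
  rw [Subsingleton.elim i 0]
  exact max_eq_left x.coord_nonneg

theorem HalfSpace.coord_ray {t : ℝ} (ht : 0 ≤ t) : (ray t).coord = t := max_eq_left ht

theorem HalfSpace.mem_boundary_one {x : HalfSpace 1} : x ∈ boundary 1 ↔ x.coord = 0 := by
  constructor
  · rintro ⟨i, -, h⟩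
    rwa [Subsingleton.elim i 0] at h
  · exact fun h => ⟨0, rfl, h⟩

/-- Since `coord` is continuous and `ray` is a continuous inverse to it on `[0, ∞)`, neighbourhood
questions on the half-line become questions about filters on `ℝ`. -/
theorem HalfSpace.nhds_eq_map_ray (x : HalfSpace 1) :
    𝓝 x = map ray (𝓝[Ici 0] x.coord) := by
  refine le_antisymm ?_ ?_
  · have h1 : Tendsto coord (𝓝 x) (𝓝[Ici 0] x.coord) :=
      tendsto_nhdsWithin_iff.2 ⟨continuous_coord.tendsto x,
        Eventually.of_forall fun y => y.coord_nonneg⟩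
    have h2 := map_mono (m := ray) h1
    rw [map_map] at h2
    have : ray ∘ coord = id := funext ray_coord
    rwa [this, map_id] at h2
  · have := continuous_ray.tendsto x.coord
    rw [ray_coord] at this
    exact this.mono_left nhdsWithin_le_nhds

/-! ### One-sided germs read in a one-dimensional chart -/

section Chart

variable {X : Type*} [TopologicalSpace X] (e : OpenPartialHomeomorph X (HalfSpace 1))

/-- The coordinates of the points of `B` in the chart `e`. -/
def chartPre (B : Set X) : Set ℝ :=
  {t | 0 ≤ t ∧ HalfSpace.ray t ∈ e.target ∧ e.symm (HalfSpace.ray t) ∈ B}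

variable {e} {B : Set X}

theorem mem_chartPre_coord {v : X} (hv : v ∈ e.source) :
    (e v).coord ∈ chartPre e B ↔ v ∈ B := by
  simp [chartPre, HalfSpace.coord_nonneg, e.map_source hv, e.left_inv hv]

theorem mem_chartPre_iff {t : ℝ} :
    t ∈ chartPre e B ↔ ∃ v ∈ e.source, v ∈ B ∧ (e v).coord = t := by
  constructor
  · rintro ⟨h0, h1, h2⟩
    refine ⟨_, e.map_target h1, h2, ?_⟩
    rw [e.right_inv h1, HalfSpace.coord_ray h0]
  · rintro ⟨v, hv, hB, rfl⟩
    exact (mem_chartPre_coord hv).2 hB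

theorem coord_injOn : InjOn (fun v => (e v).coord) e.source := by
  intro v hv w hw h
  have h' : e v = e w := by
    rw [← HalfSpace.ray_coord (e v), ← HalfSpace.ray_coord (e w)]
    exact congrArg _ h
  exact e.injOn hv hw h'

theorem mem_nhds_iff_chartPre {v : X} (hv : v ∈ e.source) :
    B ∈ 𝓝 v ↔ chartPre e B ∈ 𝓝[Ici 0] (e v).coord := by
  have h1 : 𝓝 v = map e.symm (𝓝 (e v)) := by
    rw [e.symm.map_nhds_eq (by simpa using e.map_source hv), e.left_inv hv]
  have h2 : ∀ᶠ t in 𝓝[Ici 0] (e v).coord, HalfSpace.ray t ∈ e.target := by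
    have := e.open_target.mem_nhds (e.map_source hv)
    rw [HalfSpace.nhds_eq_map_ray] at this
    exact this
  rw [h1, HalfSpace.nhds_eq_map_ray, map_map, mem_map]
  constructor
  · intro h
    filter_upwards [h, h2, self_mem_nhdsWithin] with t a b c using ⟨c, b, a⟩
  · intro h
    filter_upwards [h] with t a using a.2.2

theorem mem_nhdsNE_iff_chartPre {v : X} (hv : v ∈ e.source) :
    B ∈ 𝓝[≠] v ↔ chartPre e B ∈ 𝓝[Ici 0 \ {(e v).coord}] (e v).coord := by
  rw [mem_nhdsWithin_iff_eventually, sdiff_eq, nhdsWithin_inter',  mem_inf_principal,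
    ← eventually_mem_set (s := {x | x ∈ _ → x ∈ _})]
  -- A punctured neighbourhood condition is an ordinary one for the implication `x ≠ v → x ∈ B`, so
  -- the unpunctured lemma applies to that set.
  have := mem_nhds_iff_chartPre (B := {x | x ∈ ({v}ᶜ : Set X) → x ∈ B}) hv
  refine this.trans ⟨fun h => ?_, fun h => ?_⟩
  · filter_upwards [h] with t ht hne
    obtain ⟨w, hw, hB, rfl⟩ := mem_chartPre_iff.1 ht
    refine (mem_chartPre_coord hw).2 (hB ?_)
    rintro rfl
    exact hne rfl
  · filter_upwards [h, (mem_nhds_iff_chartPre hv).1 univ_mem] with t ht h'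
    obtain ⟨w, hw, -, rfl⟩ := mem_chartPre_iff.1 h'
    refine (mem_chartPre_coord hw).2 fun hne => (mem_chartPre_coord hw).1 (ht fun hc => hne ?_)
    exact coord_injOn hw hv hc

theorem mem_nhdsNE_iff_of_pos {v : X} (hv : v ∈ e.source) (h0 : 0 < (e v).coord) :
    B ∈ 𝓝[≠] v ↔ chartPre e B ∈ 𝓝[<] (e v).coord ∧ chartPre e B ∈ 𝓝[>] (e v).coord := by
  rw [mem_nhdsNE_iff_chartPre hv, sdiff_eq, inter_comm, nhdsWithin_inter_of_mem'
    (mem_nhdsWithin_of_mem_nhds (Ici_mem_nhds h0)), ← Iio_union_Ioi, nhdsWithin_union, mem_sup]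

theorem mem_nhdsNE_iff_of_zero {v : X} (hv : v ∈ e.source) (h0 : (e v).coord = 0) :
    B ∈ 𝓝[≠] v ↔ chartPre e B ∈ 𝓝[>] (e v).coord := by
  rw [mem_nhdsNE_iff_chartPre hv, h0, Ici_sdiff_left]

/-- No chart coordinate is negative. The missing side of an end thus behaves as an empty germ, which
lets ends and interior points share the same real-line criterion for jumps. -/
theorem compl_chartPre_mem_left {t : ℝ} (h0 : t = 0) : (chartPre e B)ᶜ ∈ 𝓝[<] t := by
  subst h0
  filter_upwards [self_mem_nhdsWithin] with t ht h
  exact absurd h.1 (not_le.2 ht)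

/-- The image of the interval in `X` is connected and misses the frontier of `B`, so it lies wholly
inside or wholly outside `B`. -/
theorem Ioo_subset_chartPre_or {a b : ℝ} (h : Ioo a b ⊆ chartPre e (frontier B)ᶜ) :
    Ioo a b ⊆ chartPre e B ∨ Ioo a b ⊆ (chartPre e B)ᶜ := by
  have hc : ContinuousOn (fun t => e.symm (HalfSpace.ray t)) (Ioo a b) :=
    e.continuousOn_symm.comp HalfSpace.continuous_ray.continuousOn fun t ht => (h ht).2.1
  have hd : Disjoint ((fun t => e.symm (HalfSpace.ray t)) '' Ioo a b) (frontier B) := by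
    rw [disjoint_left]
    rintro _ ⟨t, ht, rfl⟩
    exact (h ht).2.2
  rcases (isPreconnected_Ioo.image _ hc).subset_or_subset_compl_of_frontier hd with h' | h'
  · exact Or.inl fun t ht => ⟨(h ht).1, (h ht).2.1, h' ⟨t, ht, rfl⟩⟩
  · exact Or.inr fun t ht hB => h' ⟨t, ht, rfl⟩ hB.2.2

theorem chartPre_mem_right_or {v : X} (hv : v ∈ e.source)
    (hB : ∀ᶠ x in 𝓝[≠] v, x ∉ frontier B) :
    chartPre e B ∈ 𝓝[>] (e v).coord ∨ (chartPre e B)ᶜ ∈ 𝓝[>] (e v).coord := by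
  have h : chartPre e (frontier B)ᶜ ∈ 𝓝[>] (e v).coord := by
    rcases (e v).coord_nonneg.eq_or_lt with h0 | h0
    · exact (mem_nhdsNE_iff_of_zero hv h0.symm).1 hB
    · exact ((mem_nhdsNE_iff_of_pos hv h0).1 hB).2
  obtain ⟨u, hu, hsub⟩ := mem_nhdsGT_iff_exists_Ioo_subset.1 h
  exact (Ioo_subset_chartPre_or hsub).imp (mem_of_superset (Ioo_mem_nhdsGT hu))
    (mem_of_superset (Ioo_mem_nhdsGT hu))

theorem chartPre_mem_left_or {v : X} (hv : v ∈ e.source)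
    (hB : ∀ᶠ x in 𝓝[≠] v, x ∉ frontier B) :
    chartPre e B ∈ 𝓝[<] (e v).coord ∨ (chartPre e B)ᶜ ∈ 𝓝[<] (e v).coord := by
  rcases (e v).coord_nonneg.eq_or_lt with h0 | h0
  · exact Or.inr (compl_chartPre_mem_left h0.symm)
  obtain ⟨u, hu, hsub⟩ := mem_nhdsLT_iff_exists_Ioo_subset.1
    ((mem_nhdsNE_iff_of_pos hv h0).1 hB).1
  exact (Ioo_subset_chartPre_or hsub).imp (mem_of_superset (Ioo_mem_nhdsLT hu))
    (mem_of_superset (Ioo_mem_nhdsLT hu))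

/-- The complement of `chartPre e B` also contains parameters outside the chart; the two notions of
complement agree once the filter is concentrated on the chart. -/
theorem chartPre_compl_mem_iff {l : Filter ℝ} (h : chartPre e univ ∈ l) :
    chartPre e Bᶜ ∈ l ↔ (chartPre e B)ᶜ ∈ l := by
  constructor
  · intro h'
    filter_upwards [h'] with t ht hB using ht.2.2 hB.2.2
  · intro h'
    filter_upwards [h', h] with t ht hu using ⟨hu.1, hu.2.1, fun hB => ht ⟨hu.1, hu.2.1, hB⟩⟩

theorem chartPre_univ_mem_right {v : X} (hv : v ∈ e.source) :
    chartPre e univ ∈ 𝓝[>] (e v).coord := by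
  rcases (e v).coord_nonneg.eq_or_lt with h0 | h0
  · exact (mem_nhdsNE_iff_of_zero hv h0.symm).1 univ_mem
  · exact ((mem_nhdsNE_iff_of_pos hv h0).1 univ_mem).2

theorem chartPre_univ_mem_left {v : X} (hv : v ∈ e.source) (h0 : 0 < (e v).coord) :
    chartPre e univ ∈ 𝓝[<] (e v).coord :=
  ((mem_nhdsNE_iff_of_pos hv h0).1 univ_mem).1

/-- At an interior coordinate the part of the chart to the right of `v` splits the punctured
neighbourhood; at coordinate 0 only one side exists, and a connected interval cannot be split. Since
`IsEnd` mentions no chart, vanishing of the coordinate does not depend on the chart. -/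
theorem isEnd_iff_coord {v : X} (hv : v ∈ e.source) : IsEnd v ↔ (e v).coord = 0 := by
  constructor
  · intro h
    by_contra h0
    replace h0 : 0 < (e v).coord := lt_of_le_of_ne (e v).coord_nonneg (Ne.symm h0)
    have hcont : ContinuousOn (fun x => (e x).coord) e.source :=
      HalfSpace.continuous_coord.comp_continuousOn e.continuousOn
    set B : Set X := {x ∈ e.source | (e v).coord < (e x).coord} with hBdef
    have hpre : chartPre e B = chartPre e univ ∩ Ioi (e v).coord := by
      ext t
      rw [mem_inter_iff, mem_chartPre_iff, mem_chartPre_iff]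
      constructor
      · rintro ⟨w, hw, hB, rfl⟩
        exact ⟨⟨w, hw, trivial, rfl⟩, hB.2⟩
      · rintro ⟨⟨w, hw, -, rfl⟩, hB⟩
        exact ⟨w, hw, ⟨hw, hB⟩, rfl⟩
    -- Within the chart, the frontier of this half can only contain `v` itself.
    have htame : ∀ᶠ x in 𝓝[≠] v, x ∉ frontier B := by
      filter_upwards [mem_nhdsWithin_of_mem_nhds (e.open_source.mem_nhds hv),
        self_mem_nhdsWithin] with x hx hxv
      have hat := hcont.continuousAt (e.open_source.mem_nhds hx)
      rcases lt_trichotomy (e v).coord (e x).coord with h1 | h1 | h1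
      · have : B ∈ 𝓝 x := by
          filter_upwards [e.open_source.mem_nhds hx, hat.eventually (lt_mem_nhds h1)] with y a b
          exact ⟨a, b⟩
        exact fun hf => hf.2 (mem_interior_iff_mem_nhds.2 this)
      · exact absurd (coord_injOn hv hx h1).symm hxv
      · have : Bᶜ ∈ 𝓝 x := by
          filter_upwards [hat.eventually (gt_mem_nhds h1)] with y b hy
          exact lt_asymm hy.2 b
        intro hf
        exact (mem_closure_iff_nhds.1 hf.1 _ this).elim fun y hy => hy.1 hy.2
    -- The left germ of `B` is empty and its right germ is full, so neither `B` nor its complement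
    -- contains a punctured neighbourhood.
    rcases h B htame with h | h
    · have h1 := ((mem_nhdsNE_iff_of_pos hv h0).1 h).1
      rw [hpre] at h1
      refine notMem_of_compl_mem ?_ h1
      filter_upwards [self_mem_nhdsWithin] with t ht h
      exact lt_asymm (mem_Iio.1 ht) (mem_Ioi.1 h.2)
    · have h1 := ((mem_nhdsNE_iff_of_pos hv h0).1 h).2
      rw [chartPre_compl_mem_iff (chartPre_univ_mem_right hv), hpre] at h1
      exact notMem_of_compl_mem h1 (inter_mem (chartPre_univ_mem_right hv) self_mem_nhdsWithin)
  · intro h0 B hB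
    rw [mem_nhdsNE_iff_of_zero hv h0, mem_nhdsNE_iff_of_zero hv h0,
      chartPre_compl_mem_iff (chartPre_univ_mem_right hv)]
    exact chartPre_mem_right_or hv hB

/-- Under tameness each one-sided germ is full or empty. At an interior point, failure of both `B`
and its complement to fill the punctured neighbourhood therefore means that the two germs differ; at
an end the left germ is empty, so a jump means a full right germ. -/
theorem jumps_iff {v : X} (hv : v ∈ e.source) (hB : ∀ᶠ x in 𝓝[≠] v, x ∉ frontier B) :
    Jumps B v ↔ (e v).coord ∈ jumpSet (chartPre e B) := by
  rw [Jumps, jumpSet, mem_ofPred_eq]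
  rcases (e v).coord_nonneg.eq_or_lt with h0 | h0
  · rw [if_pos ((isEnd_iff_coord hv).2 h0.symm), mem_nhdsNE_iff_of_zero hv h0.symm]
    have := notMem_of_compl_mem (compl_chartPre_mem_left (e := e) (B := B) h0.symm)
    tauto
  · rw [if_neg (mt (isEnd_iff_coord hv).1 h0.ne'), mem_nhdsNE_iff_of_pos hv h0,
      mem_nhdsNE_iff_of_pos hv h0, chartPre_compl_mem_iff (chartPre_univ_mem_right hv),
      chartPre_compl_mem_iff (chartPre_univ_mem_left hv h0)]
    have h1 := chartPre_mem_right_or hv hB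
    have h2 := chartPre_mem_left_or hv hB
    have h3 := @notMem_of_compl_mem _ (𝓝[>] (e v).coord) _ (chartPre e B)
    have h4 := @notMem_of_compl_mem _ (𝓝[<] (e v).coord) _ (chartPre e B)
    tauto

theorem mem_union_iff_of_or {α : Type*} {l : Filter α} [l.NeBot] {A A' : Set α}
    (h : A ∈ l ∨ Aᶜ ∈ l) : A ∪ A' ∈ l ↔ A ∈ l ∨ A' ∈ l := by
  constructor
  · intro hu
    refine h.imp_right fun h => ?_
    filter_upwards [h, hu] with x h1 h2 using h2.resolve_left h1
  · rintro (h | h)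
    · exact mem_of_superset h subset_union_left
    · exact mem_of_superset h subset_union_right

/-- A germ of a disjoint union is full iff exactly one of the two germs is, so the indicators of
full germs add, and their left-right differences add modulo 2. -/
theorem jumps_union_iff {B' : Set X} {v : X} (hv : v ∈ e.source)
    (hB : ∀ᶠ x in 𝓝[≠] v, x ∉ frontier B) (hB' : ∀ᶠ x in 𝓝[≠] v, x ∉ frontier B')
    (hd : Disjoint B B') : Jumps (B ∪ B') v ↔ ¬ (Jumps B v ↔ Jumps B' v) := by
  have hU : ∀ᶠ x in 𝓝[≠] v, x ∉ frontier (B ∪ B') := by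
    filter_upwards [hB, hB'] with x h1 h2 h
    exact (frontier_union_subset B B' h).elim (fun h => h1 h.1) (fun h => h2 h.2)
  have hpre : chartPre e (B ∪ B') = chartPre e B ∪ chartPre e B' := by
    ext t
    simp only [chartPre, mem_ofPred_eq, mem_union]
    tauto
  have hpd : Disjoint (chartPre e B) (chartPre e B') :=
    disjoint_left.2 fun t h h' => disjoint_left.1 hd h.2.2 h'.2.2
  rw [jumps_iff hv hB, jumps_iff hv hB', jumps_iff hv hU, hpre]
  simp only [jumpSet, mem_ofPred_eq]
  rw [mem_union_iff_of_or (chartPre_mem_left_or hv hB),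
    mem_union_iff_of_or (chartPre_mem_right_or hv hB)]
  have hnb : ∀ (l : Filter ℝ) [l.NeBot], chartPre e B ∈ l → chartPre e B' ∈ l → False := by
    intro l _ h h'
    have := inter_mem h h'
    rw [hpd.inter_eq] at this
    exact empty_notMem l this
  have h1 := hnb (𝓝[<] (e v).coord)
  have h2 := hnb (𝓝[>] (e v).coord)
  tauto

end Chart

theorem eventually_notMem_of_finite {X : Type*} [TopologicalSpace X] [T1Space X] {F : Set X}
    (hF : F.Finite) (v : X) : ∀ᶠ x in 𝓝[≠] v, x ∉ F := by
  have h : (F \ {v})ᶜ ∈ 𝓝 v :=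
    (hF.subset sdiff_subset).isClosed.isOpen_compl.mem_nhds (by simp)
  filter_upwards [mem_nhdsWithin_of_mem_nhds h, self_mem_nhdsWithin] with x h1 h2 h3
  exact h1 ⟨h3, h2⟩

theorem even_ncard_of_symmDiff {α : Type*} {A B C : Set α} (hA : A.Finite) (hB : B.Finite)
    (eA : Even A.ncard) (eB : Even B.ncard) (h : ∀ x, x ∈ C ↔ ¬ (x ∈ A ↔ x ∈ B)) :
    Even C.ncard := by
  have h1 : C = (A \ B) ∪ (B \ A) := by
    ext x
    rw [h, mem_union, Set.mem_sdiff, Set.mem_sdiff]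
    tauto
  have h2 : Disjoint (A \ B) (B \ A) := disjoint_left.2 fun x hx hx' => hx.2 hx'.1
  have h3 := ncard_inter_add_ncard_sdiff_eq_ncard A B hA
  have h4 := ncard_inter_add_ncard_sdiff_eq_ncard B A hB
  rw [h1, ncard_union_eq h2 (hA.subset sdiff_subset) (hB.subset sdiff_subset)]
  rw [inter_comm] at h4
  rw [← h3] at eA
  rw [← h4] at eB
  grind

/-! ### Parity of jumps and ends in a compact one-manifold -/

section Compact

variable {X : Type*} [TopologicalSpace X]

/-- Each chart domain contains at most one end, the point with coordinate 0, and finitely many chart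
domains cover `M`. -/
theorem finite_isEnd {M : Set X} (hM : IsCompact M)
    (hch : ∀ v ∈ M, ∃ e : OpenPartialHomeomorph X (HalfSpace 1), v ∈ e.source) :
    (M ∩ {v | IsEnd v}).Finite := by
  refine hM.induction_on (p := fun s => (s ∩ {v | IsEnd v}).Finite) (by simp)
    (fun s t hst h => h.subset (inter_subset_inter_left _ hst))
    (fun s t hs ht => by rw [union_inter_distrib_right]; exact hs.union ht) fun v hv => ?_
  obtain ⟨e, he⟩ := hch v hv
  refine ⟨e.source, mem_nhdsWithin_of_mem_nhds (e.open_source.mem_nhds he), ?_⟩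
  refine Set.Subsingleton.finite fun x hx y hy => coord_injOn hx.1 hy.1 ?_
  exact ((isEnd_iff_coord hx.1).1 hx.2).trans ((isEnd_iff_coord hy.1).1 hy.2).symm

/-- Off the frontier, `B` or its complement is a neighbourhood of the point, which rules out a jump
unless the point is an end. -/
theorem jumps_subset (B : Set X) : {v | Jumps B v} ⊆ frontier B ∪ {v | IsEnd v} := by
  intro v hv
  by_contra hc
  rw [mem_union, not_or] at hc
  obtain ⟨h1, h2⟩ := hc
  replace hv : Jumps B v := hv
  rw [Jumps, if_neg (show ¬ IsEnd v from h2)] at hv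
  refine h1 ⟨by_contra fun h => hv.2 ?_, fun h => hv.1 ?_⟩
  · exact mem_nhdsWithin_of_mem_nhds (mem_of_superset (isClosed_closure.isOpen_compl.mem_nhds h)
      (compl_subset_compl.2 subset_closure))
  · exact mem_nhdsWithin_of_mem_nhds (mem_interior_iff_mem_nhds.1 h)

theorem finite_jumps {M B : Set X} (hM : IsCompact M)
    (hch : ∀ v ∈ M, ∃ e : OpenPartialHomeomorph X (HalfSpace 1), v ∈ e.source)
    (hB : (frontier B).Finite) : (M ∩ {v | Jumps B v}).Finite := by
  refine (hB.union (finite_isEnd hM hch)).subset ?_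
  rintro v ⟨h1, h2⟩
  exact (jumps_subset B h2).imp_right fun h => ⟨h1, h⟩

theorem not_jumps_of_compl_mem {e : OpenPartialHomeomorph X (HalfSpace 1)} {B : Set X} {v : X}
    (hv : v ∈ e.source) (h : Bᶜ ∈ 𝓝 v) : ¬ Jumps B v := by
  rw [Jumps]
  split_ifs with hend
  · intro hB
    have h0 := (isEnd_iff_coord hv).1 hend
    have h1 := (mem_nhdsNE_iff_of_zero hv h0).1 (inter_mem hB (mem_nhdsWithin_of_mem_nhds h))
    obtain ⟨t, ht⟩ := Filter.nonempty_of_mem h1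
    exact ht.2.2.2 ht.2.2.1
  · exact fun h' => h'.2 (mem_nhdsWithin_of_mem_nhds h)

/-- The arc is the set of chart points with coordinate in a small closed interval around that of
`v`. Compactness comes from parametrizing it by the interval, and only the two endpoints of the
interval can produce frontier points. -/
theorem exists_arc [T2Space X] {M : Set X} (hM : IsOpen M) {v : X} (hv : v ∈ M)
    {e : OpenPartialHomeomorph X (HalfSpace 1)} (he : v ∈ e.source) :
    ∃ K : Set X, K ∈ 𝓝 v ∧ K ⊆ M ∧ K ⊆ e.source ∧ IsCompact K ∧ (frontier K).Finite ∧
      ∃ a b, chartPre e K = Icc a b := by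
  set t₀ := (e v).coord with ht₀
  obtain ⟨δ, hδ, hsub⟩ := Metric.mem_nhdsWithin_iff.1
    ((mem_nhds_iff_chartPre he).1 (hM.mem_nhds hv))
  rw [← ht₀] at hsub
  -- Radius `δ / 2` keeps the closed interval inside the ball of radius `δ`; truncation at 0 keeps
  -- it in the half-line.
  have hI : Icc (max 0 (t₀ - δ / 2)) (t₀ + δ / 2) ⊆ chartPre e M := by
    intro t ht
    have h1 := max_le_iff.1 ht.1
    refine hsub ⟨?_, h1.1⟩
    rw [Metric.mem_ball, Real.dist_eq, abs_lt]
    constructor <;> linarith [ht.2, h1.2]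
  set I := Icc (max 0 (t₀ - δ / 2)) (t₀ + δ / 2) with hIdef
  set K : Set X := {w ∈ e.source | (e w).coord ∈ I} with hK
  have hpre : chartPre e K = I := by
    ext t
    rw [mem_chartPre_iff]
    constructor
    · rintro ⟨w, -, hw, rfl⟩
      exact hw.2
    · intro ht
      obtain ⟨w, hw, -, rfl⟩ := mem_chartPre_iff.1 (hI ht)
      exact ⟨w, hw, ⟨hw, ht⟩, rfl⟩
  have hKimg : K = (fun t => e.symm (HalfSpace.ray t)) '' I := by
    ext w
    constructor
    · intro hw
      exact ⟨_, hw.2, by simp [e.left_inv hw.1]⟩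
    · rintro ⟨t, ht, rfl⟩
      rw [← hpre] at ht
      exact ht.2.2
  have hKc : IsCompact K := by
    rw [hKimg]
    exact isCompact_Icc.image_of_continuousOn (e.continuousOn_symm.comp
      HalfSpace.continuous_ray.continuousOn fun t ht => (hI ht).2.1)
  -- Coordinate 0 needs no exclusion here: the truncated interval is a neighbourhood of 0 within the
  -- half-line whenever `t₀ - δ / 2 < 0`.
  have hint : ∀ w ∈ e.source, t₀ - δ / 2 < (e w).coord → (e w).coord < t₀ + δ / 2 →
      K ∈ 𝓝 w := by
    intro w hw h1 h2
    rw [mem_nhds_iff_chartPre hw, hpre]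
    filter_upwards [mem_nhdsWithin_of_mem_nhds (Ioo_mem_nhds h1 h2), self_mem_nhdsWithin]
      with t ht ht0
    exact ⟨max_le ht0 ht.1.le, ht.2.le⟩
  refine ⟨K, hint v he (by linarith) (by linarith), ?_, fun w hw => hw.1, hKc, ?_, _, _, hpre⟩
  · intro w hw
    exact (mem_chartPre_coord hw.1).1 (hI hw.2)
  · have hf : frontier K ⊆ K := hKc.isClosed.frontier_subset
    refine Set.Finite.of_injOn (f := fun w => (e w).coord) (t := {t₀ - δ / 2, t₀ + δ / 2})
      (fun w hw => ?_) (coord_injOn.mono fun w hw => (hf hw).1) (by simp)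
    have h1 := (hf hw).2
    have h2 := max_le_iff.1 h1.1
    by_contra hc
    simp only [mem_insert_iff, mem_singleton_iff, not_or] at hc
    exact hw.2 (mem_interior_iff_mem_nhds.2 (hint w (hf hw).1
      (lt_of_le_of_ne h2.2 (Ne.symm hc.1)) (lt_of_le_of_ne h1.2 hc.2)))

/-- Since `K` is closed, `B` has no jumps outside it. The chart coordinate is injective and matches
the jumps of `B` with the jumps of a subset of `[a, b]`, where the parity is known. -/
theorem even_ncard_jumps_of_subset_arc [T2Space X] {M K B : Set X} (hM : IsCompact M)
    (hch : ∀ v ∈ M, ∃ e : OpenPartialHomeomorph X (HalfSpace 1), v ∈ e.source)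
    {e : OpenPartialHomeomorph X (HalfSpace 1)} (hKM : K ⊆ M) (hKe : K ⊆ e.source)
    (hK : IsCompact K) {a b : ℝ} (hab : chartPre e K = Icc a b) (hBK : B ⊆ K)
    (hB : (frontier B).Finite) : Even (M ∩ {v | Jumps B v}).ncard := by
  have hJK : M ∩ {v | Jumps B v} ⊆ K := by
    rintro v ⟨hv, hj⟩
    by_contra hc
    obtain ⟨f, hf⟩ := hch v hv
    exact not_jumps_of_compl_mem hf
      (mem_of_superset (hK.isClosed.isOpen_compl.mem_nhds hc) (compl_subset_compl.2 hBK)) hj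
  have hsub : chartPre e B ⊆ Icc a b := by
    rw [← hab]
    exact fun t ht => ⟨ht.1, ht.2.1, hBK ht.2.2⟩
  have hout : ∀ t, t ∉ Icc a b → (chartPre e B)ᶜ ∈ 𝓝 t := fun t ht =>
    mem_of_superset (isClosed_Icc.isOpen_compl.mem_nhds ht) (compl_subset_compl.2 hsub)
  have himg : (fun w => (e w).coord) '' (M ∩ {v | Jumps B v}) = jumpSet (chartPre e B) := by
    ext t
    constructor
    · rintro ⟨w, hw, rfl⟩
      exact (jumps_iff (hKe (hJK hw)) (eventually_notMem_of_finite hB w)).1 hw.2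
    · intro ht
      have htI : t ∈ Icc a b := by
        by_contra hc
        exact ht ⟨fun h => absurd h (notMem_of_compl_mem (mem_nhdsWithin_of_mem_nhds (hout t hc))),
          fun h => absurd h (notMem_of_compl_mem (mem_nhdsWithin_of_mem_nhds (hout t hc)))⟩
      rw [← hab] at htI
      obtain ⟨w, hw, hwK, rfl⟩ := mem_chartPre_iff.1 htI
      exact ⟨w, ⟨hKM hwK, (jumps_iff hw (eventually_notMem_of_finite hB w)).2 ht⟩, rfl⟩
  have hfin := finite_jumps hM hch hB
  rw [← (coord_injOn.mono (hJK.trans hKe)).ncard_image, himg]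
  have htame : ∀ t, (chartPre e B ∈ 𝓝[>] t ∨ (chartPre e B)ᶜ ∈ 𝓝[>] t) ∧
      (chartPre e B ∈ 𝓝[<] t ∨ (chartPre e B)ᶜ ∈ 𝓝[<] t) := by
    intro t
    by_cases ht : t ∈ Icc a b
    · rw [← hab] at ht
      obtain ⟨w, hw, -, rfl⟩ := mem_chartPre_iff.1 ht
      exact ⟨chartPre_mem_right_or hw (eventually_notMem_of_finite hB w),
        chartPre_mem_left_or hw (eventually_notMem_of_finite hB w)⟩
    · exact ⟨Or.inr (mem_nhdsWithin_of_mem_nhds (hout t ht)),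
        Or.inr (mem_nhdsWithin_of_mem_nhds (hout t ht))⟩
  refine even_ncard_jumpSet hsub (fun t => (htame t).1) (fun t => (htame t).2) ?_
  rw [← himg]
  exact hfin.image _

theorem finite_frontier_inter {A B : Set X} (hA : (frontier A).Finite) (hB : (frontier B).Finite) :
    (frontier (A ∩ B)).Finite :=
  (hA.union hB).subset ((frontier_inter_subset A B).trans
    (union_subset_union inter_subset_left inter_subset_right))

theorem finite_frontier_union {A B : Set X} (hA : (frontier A).Finite) (hB : (frontier B).Finite) :
    (frontier (A ∪ B)).Finite :=
  (hA.union hB).subset ((frontier_union_subset A B).trans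
    (union_subset_union inter_subset_left inter_subset_right))

/-- A compact one-dimensional manifold has an even number of ends. -/
theorem even_ncard_isEnd [T2Space X] {M : Set X} (hM : IsCompact M) (hMo : IsOpen M)
    (hch : ∀ v ∈ M, ∃ e : OpenPartialHomeomorph X (HalfSpace 1), v ∈ e.source) :
    Even (M ∩ {v | IsEnd v}).ncard := by
  -- The property used in the compactness induction quantifies over all tame subsets `B` of an
  -- enlargement `s'`, so that a subset of a union can be cut into pieces to which the hypotheses
  -- apply.
  have key : ∃ s', M ⊆ s' ∧ (frontier s').Finite ∧ ∀ B ⊆ s', (frontier B).Finite →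
      Even (M ∩ {v | Jumps B v}).ncard := by
    refine hM.induction_on (p := fun s => ∃ s', s ⊆ s' ∧ (frontier s').Finite ∧
      ∀ B ⊆ s', (frontier B).Finite → Even (M ∩ {v | Jumps B v}).ncard) ?_ ?_ ?_ ?_
    · refine ⟨∅, subset_rfl, by simp, fun B hB _ => ?_⟩
      obtain rfl := subset_empty_iff.1 hB
      have : M ∩ {v | Jumps (∅ : Set X) v} = ∅ := by
        rw [eq_empty_iff_forall_notMem]
        rintro v ⟨hv, hj⟩
        obtain ⟨f, hf⟩ := hch v hv
        exact not_jumps_of_compl_mem hf (by simp) hj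
      rw [this, ncard_empty]
      exact Even.zero
    · rintro s t hst ⟨s', h, h'⟩
      exact ⟨s', hst.trans h, h'⟩
    · rintro s t ⟨s', hs, hsf, hse⟩ ⟨t', ht, htf, hte⟩
      refine ⟨s' ∪ t', union_subset_union hs ht, finite_frontier_union hsf htf,
        fun B hB hBf => ?_⟩
      have f1 : (frontier (B ∩ s')).Finite := finite_frontier_inter hBf hsf
      have f2 : (frontier (B ∩ s'ᶜ)).Finite :=
        finite_frontier_inter hBf (by rwa [frontier_compl])
      -- Cutting `B` along `s'` makes its jump set the symmetric difference of the jump sets of the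
      -- two pieces.
      refine even_ncard_of_symmDiff (finite_jumps hM hch f1) (finite_jumps hM hch f2)
        (hse _ inter_subset_right f1)
        (hte _ (fun x hx => (hB hx.1).resolve_left hx.2) f2) fun v => ?_
      by_cases hv : v ∈ M
      · obtain ⟨e, he⟩ := hch v hv
        have := jumps_union_iff he (eventually_notMem_of_finite f1 v)
          (eventually_notMem_of_finite f2 v)
          (disjoint_left.2 fun x hx hx' => hx'.2 hx.2)
        rw [inter_union_compl] at this
        simpa [hv] using this
      · simp [hv]
    · intro v hv
      obtain ⟨e, he⟩ := hch v hv
      obtain ⟨K, hKv, hKM, hKe, hKc, hKf, a, b, hab⟩ := exists_arc hMo hv he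
      exact ⟨K, mem_nhdsWithin_of_mem_nhds hKv, K, subset_rfl, hKf, fun B hB hBf =>
        even_ncard_jumps_of_subset_arc hM hch hKM hKe hKc hab hB hBf⟩
  obtain ⟨s', h1, -, h2⟩ := key
  -- `M` is clopen, so its frontier is empty; it fills every punctured neighbourhood of its points,
  -- so it jumps exactly at its ends.
  have h3 := h2 M h1 (by rw [IsClopen.frontier_eq ⟨hM.isClosed, hMo⟩]; exact finite_empty)
  have h4 : M ∩ {v | Jumps M v} = M ∩ {v | IsEnd v} := by
    ext v
    refine and_congr_right fun hv => ?_
    have hn : M ∈ 𝓝[≠] v := mem_nhdsWithin_of_mem_nhds (hMo.mem_nhds hv)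
    change Jumps M v ↔ IsEnd v
    rw [Jumps]
    split_ifs with h <;> simp [h, hn]
  rwa [h4] at h3

end Compact

/-! ### Dimensions zero and one -/

namespace C0Manifold

/-- Moving the coordinate `i` of a point of the half-space. -/
def shift {d : ℕ} (i : Fin d) (z : HalfSpace d) (ε : ℝ) : HalfSpace d :=
  ⟨fun j => if j = i then z.1 j + |ε| else z.1 j, fun j hj => by
    have := z.2 j hj
    beta_reduce
    split_ifs
    · positivity
    · exact this⟩

theorem continuous_shift {d : ℕ} (i : Fin d) (z : HalfSpace d) : Continuous (shift i z) := by
  refine Continuous.subtype_mk (continuous_pi fun j => ?_) _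
  split_ifs
  · exact continuous_const.add continuous_abs
  · exact continuous_const

theorem shift_zero {d : ℕ} (i : Fin d) (z : HalfSpace d) : shift i z 0 = z :=
  Subtype.ext (funext fun j => by simp [shift])

theorem shift_ne {d : ℕ} (i : Fin d) (z : HalfSpace d) {ε : ℝ} (hε : ε ≠ 0) :
    shift i z ε ≠ z := by
  intro h
  have := congrFun (congrArg Subtype.val h) i
  simp [shift, hε] at this

/-- In positive dimension this moves a point off itself along one coordinate. It shows that such
points are not isolated and, for a tangential coordinate, that boundary points are not isolated in
the boundary. -/
theorem tendsto_symm_shift {X : Type*} [TopologicalSpace X] {d : ℕ} (i : Fin d) (e : OpenPartialHomeomorph X (HalfSpace d))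
    {x : X} (hx : x ∈ e.source) :
    Tendsto (fun ε => e.symm (shift i (e x) ε)) (𝓝[≠] 0) (𝓝[≠] x) := by
  have h1 : Tendsto (shift i (e x)) (𝓝[≠] 0) (𝓝 (e x)) := by
    have := (continuous_shift i (e x)).tendsto 0
    rw [shift_zero] at this
    exact this.mono_left nhdsWithin_le_nhds
  refine tendsto_nhdsWithin_iff.2 ⟨(e.tendsto_symm hx).comp h1, ?_⟩
  filter_upwards [self_mem_nhdsWithin, h1 (e.open_target.mem_nhds (e.map_source hx))]
    with ε hε ht hc
  refine shift_ne i (e x) hε ?_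
  rw [← e.right_inv ht]
  exact congrArg e hc

variable {X : Type*} [TopologicalSpace X] [C0Manifold X]

theorem exists_chart_of_dim {x : X} {d : ℕ} (hd : dim x = d) :
    ∃ e : OpenPartialHomeomorph X (HalfSpace d), x ∈ e.source := by
  subst hd
  exact exists_chart x

theorem mem_boundary_iff_of_dim {x : X} {d : ℕ} (hd : dim x = d) :
    x ∈ boundary X ↔ ∃ e : OpenPartialHomeomorph X (HalfSpace d),
      x ∈ e.source ∧ e x ∈ HalfSpace.boundary d := by
  subst hd
  rfl

theorem notMem_boundary_of_dim_zero {x : X} (hx : dim x = 0) : x ∉ boundary X := by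
  rw [mem_boundary_iff_of_dim hx]
  rintro ⟨e, -, i, -⟩
  exact i.elim0

theorem isOpen_singleton_of_dim_zero {x : X} (hx : dim x = 0) : IsOpen {x} := by
  obtain ⟨e, he⟩ := exists_chart_of_dim hx
  have : e.source = {x} := by
    refine Subset.antisymm (fun y hy => e.injOn hy he (Subsingleton.elim _ _)) ?_
    simpa using he
  rw [← this]
  exact e.open_source

theorem dim_zero_of_isOpen_singleton {x : X} (hx : IsOpen {x}) : dim x = 0 := by
  by_contra hd
  obtain ⟨e, he⟩ := exists_chart x
  have h := tendsto_symm_shift ⟨0, Nat.pos_of_ne_zero hd⟩ e he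
  rw [(isOpen_singleton_iff_punctured_nhds x).1 hx] at h
  exact (h.neBot).ne rfl

/-- The boundary is defined through the existence of some chart, whereas `IsEnd` is intrinsic, so in
dimension 1 any chart detects the boundary. -/
theorem mem_boundary_iff_isEnd {x : X} (hx : dim x = 1) : x ∈ boundary X ↔ IsEnd x := by
  rw [mem_boundary_iff_of_dim hx]
  constructor
  · rintro ⟨e, he, hb⟩
    exact (isEnd_iff_coord he).2 (HalfSpace.mem_boundary_one.1 hb)
  · intro h
    obtain ⟨e, he⟩ := exists_chart_of_dim hx
    exact ⟨e, he, HalfSpace.mem_boundary_one.2 ((isEnd_iff_coord he).1 h)⟩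

theorem isOpen_dim_eq (d : ℕ) : IsOpen {x : X | dim x = d} :=
  isLocallyConstant_dim.isOpen_fiber d

theorem exists_isolating_of_dim_one {x : X} (hx : dim x = 1) (hb : x ∈ boundary X) :
    ∃ U : Set X, IsOpen U ∧ U ∩ boundary X = {x} := by
  obtain ⟨e, he⟩ := exists_chart_of_dim hx
  refine ⟨e.source ∩ {y | dim y = 1}, e.open_source.inter (isOpen_dim_eq 1),
    Subset.antisymm ?_ (by simpa using ⟨⟨he, hx⟩, hb⟩)⟩
  rintro y ⟨⟨hy, hy1⟩, hyb⟩
  refine coord_injOn hy he (((isEnd_iff_coord hy).1 ((mem_boundary_iff_isEnd hy1).1 hyb)).trans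
    ((isEnd_iff_coord he).1 ((mem_boundary_iff_isEnd hx).1 hb)).symm)

/-- Dimension 0 has no boundary. In dimension at least 2, moving the second coordinate while the
first stays 0 gives boundary points arbitrarily close to `x`. -/
theorem dim_one_of_isolated {x : X} {U : Set X} (hU : IsOpen U) (h : U ∩ boundary X = {x}) :
    dim x = 1 := by
  have hxU : x ∈ U ∩ boundary X := by rw [h]; rfl
  by_contra h1
  have h0 : dim x ≠ 0 := fun h0 => notMem_boundary_of_dim_zero h0 hxU.2
  obtain ⟨e, he, i, hi, hi0⟩ := hxU.2
  have hlim := tendsto_symm_shift ⟨1, by omega⟩ e he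
  have hev : ∀ᶠ y in 𝓝[≠] x, y ∉ boundary X := by
    filter_upwards [mem_nhdsWithin_of_mem_nhds (hU.mem_nhds hxU.1), self_mem_nhdsWithin]
      with y hy hne hb
    have : y ∈ U ∩ boundary X := ⟨hy, hb⟩
    rw [h] at this
    exact hne this
  have hdim : ∀ᶠ y in 𝓝[≠] x, dim y = dim x :=
    mem_nhdsWithin_of_mem_nhds ((isOpen_dim_eq (dim x)).mem_nhds rfl)
  have hsrc : ∀ᶠ ε in 𝓝[≠] (0 : ℝ), shift ⟨1, by omega⟩ (e x) ε ∈ e.target := by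
    have := (continuous_shift ⟨1, by omega⟩ (e x)).tendsto 0
    rw [shift_zero] at this
    exact mem_nhdsWithin_of_mem_nhds (this (e.open_target.mem_nhds (e.map_source he)))
  obtain ⟨ε, hε1, hε2, hε3⟩ :=
    ((hlim.eventually hev).and ((hlim.eventually hdim).and hsrc)).exists
  -- The nearby point is a boundary point because `e` is a chart of the same dimension there and its
  -- normal coordinate `i` is still 0.
  refine hε1 ((mem_boundary_iff_of_dim hε2).2 ⟨e, e.map_target hε3, i, hi, ?_⟩)
  rw [e.right_inv hε3]
  have hne : i ≠ ⟨1, by omega⟩ := fun hc => by rw [hc] at hi; simp at hi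
  simpa [shift, hne] using hi0

end C0Manifold

/-! ### The zero-dimensional part of a system of boundary faces -/

namespace IsBoundaryFaceSystem

open C0Manifold

variable {ι : Type*} [Finite ι] {F : ι → Type*} [∀ i, TopologicalSpace (F i)]
  [∀ i, C0Manifold (F i)] {X : Type*} [TopologicalSpace X] [C0Manifold X] {φ : ∀ i, F i → X}

theorem mem_boundary (h : IsBoundaryFaceSystem φ) (i : ι) (y : F i) : φ i y ∈ boundary X :=
  h.range_subset i ⟨y, rfl⟩

/-- Both sides express isolation. If the image is isolated in the boundary, pulling back along the
embedding isolates `y` in the face. Conversely an isolated `y` is an interior point of its face, and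
the interior has image open in the boundary. -/
theorem dim_eq_one_iff (h : IsBoundaryFaceSystem φ) (i : ι) (y : F i) :
    dim (φ i y) = 1 ↔ dim y = 0 := by
  constructor
  · intro h1
    obtain ⟨U, hU, hUb⟩ := exists_isolating_of_dim_one h1 (h.mem_boundary i y)
    refine dim_zero_of_isOpen_singleton ?_
    have : {y} = φ i ⁻¹' U := by
      refine Subset.antisymm ?_ fun z hz => (h.isEmbedding i).injective ?_
      · rw [singleton_subset_iff]
        exact (hUb.ge rfl : φ i y ∈ U ∩ boundary X).1
      · exact hUb.le ⟨hz, h.mem_boundary i z⟩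
    rw [this]
    exact hU.preimage (h.isEmbedding i).continuous
  · intro h0
    obtain ⟨V, hV, hVy⟩ := (h.isEmbedding i).isOpen_iff.1 (isOpen_singleton_of_dim_zero h0)
    obtain ⟨U, hU, hUi⟩ := h.isOpen_interior i
    refine dim_one_of_isolated (hV.inter hU) (Subset.antisymm ?_ ?_)
    · rintro z ⟨⟨hz1, hz2⟩, hz3⟩
      obtain ⟨w, -, rfl⟩ := hUi.ge ⟨hz2, hz3⟩
      have : w ∈ φ i ⁻¹' V := hz1
      rw [hVy] at this
      exact congrArg (φ i) this
    · rw [singleton_subset_iff]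
      have h1 : y ∈ φ i ⁻¹' V := by rw [hVy]; rfl
      have h2 := hUi.le ⟨y, notMem_boundary_of_dim_zero h0, rfl⟩
      exact ⟨⟨h1, h2.1⟩, h2.2⟩

/-- A one-dimensional boundary point is isolated in the boundary, so density of the images of the
face interiors forces it to lie in one of them. -/
theorem exists_face (h : IsBoundaryFaceSystem φ) {x : X} (hx : dim x = 1) (hb : x ∈ boundary X) :
    ∃ i, ∃ y : F i, φ i y = x := by
  obtain ⟨U, hU, hUb⟩ := exists_isolating_of_dim_one hx hb
  have hxU : x ∈ U := (hUb.ge rfl : x ∈ U ∩ boundary X).1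
  obtain ⟨z, hz, hz'⟩ := mem_closure_iff.1 (h.closure_eq.ge hb) U hU hxU
  obtain ⟨i, y, -, rfl⟩ := mem_iUnion.1 hz'
  exact ⟨i, y, hUb.le ⟨hz, h.mem_boundary i y⟩⟩

theorem eq_of_eq (h : IsBoundaryFaceSystem φ) {i j : ι} {y : F i} {z : F j} (hy : dim y = 0)
    (hz : dim z = 0) (hyz : φ i y = φ j z) : i = j := by
  by_contra hij
  exact disjoint_left.1 (h.disjoint i j hij) ⟨y, notMem_boundary_of_dim_zero hy, rfl⟩
    ⟨z, notMem_boundary_of_dim_zero hz, hyz.symm⟩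

end IsBoundaryFaceSystem

/-! ### Novikov counts -/

theorem Novikov.ext_coeff {a b : Novikov} (h : ∀ E, a.coeff E = b.coeff E) : a = b :=
  Subtype.ext (HahnSeries.ext (funext h))

theorem HasNovikovCount.unique {Y : Type*} {e : Y → ℝ} {a b : Novikov} (ha : HasNovikovCount e a)
    (hb : HasNovikovCount e b) : a = b :=
  Novikov.ext_coeff fun E => (ha.2 E).trans (hb.2 E).symm

theorem HasNovikovCount.eq_zero {Y : Type*} {e : Y → ℝ} {a : Novikov} (ha : HasNovikovCount e a)
    (h : ∀ E, Even (Nat.card {y // e y = E})) : a = 0 :=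
  Novikov.ext_coeff fun E => (ha.2 E).trans (ZMod.natCast_eq_zero_iff_even.2 (h E))

theorem exists_hasNovikovCount {Y : Type*} {e : Y → ℝ} (h : ∀ E : ℝ, {y | e y ≤ E}.Finite) :
    ∃ a, HasNovikovCount e a := by
  let f : ℝ → ZMod 2 := fun E => (Nat.card {y // e y = E} : ZMod 2)
  have hfin : ∀ E : ℝ, (Function.support f ∩ Iic E).Finite := by
    intro E
    refine ((h E).image e).subset ?_
    rintro x ⟨hx, hxE⟩
    have : Nonempty {y // e y = x} := by
      by_contra hc
      rw [not_nonempty_iff] at hc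
      exact hx (by simp [f])
    obtain ⟨y, rfl⟩ := this
    exact ⟨y, hxE, rfl⟩
  -- A strictly descending sequence of exponents would stay below its first term, where only
  -- finitely many exponents occur.
  have hwf : (Function.support f).IsPWO := by
    refine Set.IsWF.isPWO ?_
    rw [Set.isWF_iff_no_descending_seq]
    intro g hg hmem
    have : (range g).Finite := by
      refine (hfin (g 0)).subset ?_
      rintro _ ⟨k, rfl⟩
      exact ⟨hmem k, hg.antitone (Nat.zero_le k)⟩
    exact infinite_range_of_injective hg.injective this
  exact ⟨⟨⟨f, hwf⟩, hfin⟩, h, fun E => rfl⟩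

theorem exists_le_of_finite_sublevel {Y : Type*} {e : Y → ℝ} (h : ∀ E : ℝ, {y | e y ≤ E}.Finite) :
    ∃ m, ∀ y, m ≤ e y := by
  obtain ⟨m, hm⟩ := ((h 0).image e).bddBelow
  refine ⟨min m 0, fun y => ?_⟩
  rcases le_total (e y) 0 with hy | hy
  · exact (min_le_left _ _).trans (hm ⟨y, hy, rfl⟩)
  · exact (min_le_right _ _).trans hy

/-- Pairs of total energy `E` are grouped by their energies `(i, j)` with `i + j = E`; each group is
a product of level sets, which matches the convolution formula for coefficients. Sublevel sets are
finite because each energy is bounded below. -/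
theorem HasNovikovCount.prod {Y Z : Type*} {e : Y → ℝ} {f : Z → ℝ} {a b : Novikov}
    (ha : HasNovikovCount e a) (hb : HasNovikovCount f b) :
    HasNovikovCount (fun p : Y × Z => e p.1 + f p.2) (a * b) := by
  classical
  have hfin : ∀ E : ℝ, {p : Y × Z | e p.1 + f p.2 ≤ E}.Finite := by
    intro E
    obtain ⟨m, hm⟩ := exists_le_of_finite_sublevel ha.1
    obtain ⟨m', hm'⟩ := exists_le_of_finite_sublevel hb.1
    refine ((ha.1 (E - m')).prod (hb.1 (E - m))).subset ?_
    rintro ⟨y, z⟩ h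
    have h : e y + f z ≤ E := h
    have h1 := hm y
    have h2 := hm' z
    exact ⟨show e y ≤ E - m' by linarith, show f z ≤ E - m by linarith⟩
  refine ⟨hfin, fun E => ?_⟩
  have hS : {p : Y × Z | e p.1 + f p.2 = E}.Finite := (hfin E).subset fun p hp => le_of_eq hp
  let S : Finset (Y × Z) := hS.toFinset
  have hSmem : ∀ p, p ∈ S ↔ e p.1 + f p.2 = E := fun p => hS.mem_toFinset
  have hcard : Nat.card {p : Y × Z // e p.1 + f p.2 = E} = S.card := by
    rw [← Nat.card_eq_finsetCard]
    exact Nat.card_congr (Equiv.subtypeEquivRight fun p => (hSmem p).symm)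
  rw [hcard]
  let g : Y × Z → ℝ × ℝ := fun p => (e p.1, f p.2)
  have hfib : ∀ x ∈ S.image g, (((S.filter fun p => g p = x).card : ℕ) : ZMod 2) =
      a.coeff x.1 * b.coeff x.2 := by
    rintro ⟨i, j⟩ hx
    obtain ⟨p, hp, hpx⟩ := Finset.mem_image.1 hx
    have hij : i + j = E := by
      rw [hSmem] at hp
      simp only [g, Prod.mk.injEq] at hpx
      rw [← hpx.1, ← hpx.2, hp]
    rw [ha.2, hb.2, ← Nat.cast_mul, ← Nat.card_prod, ← Nat.card_eq_finsetCard]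
    refine congrArg _ (Nat.card_congr ?_)
    refine (Equiv.subtypeEquivRight (q := fun p : Y × Z => e p.1 = i ∧ f p.2 = j)
      fun p => ?_).trans (Equiv.subtypeProdEquivProd (p := fun y => e y = i) (q := fun z => f z = j))
    rw [Finset.mem_filter, hSmem, Prod.mk.injEq]
    refine and_iff_right_of_imp ?_
    rintro ⟨h1, h2⟩
    rw [h1, h2, hij]
  rw [Finset.card_eq_sum_card_image g S, Nat.cast_sum, Finset.sum_congr rfl hfib]
  change (a.1 * b.1).coeff E = _
  rw [HahnSeries.coeff_mul]
  -- The convolution runs only over pairs of nonzero coefficients. Further energy pairs may be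
  -- realized, but then one of the two level sets is even and the term vanishes.
  refine Finset.sum_subset ?_ ?_
  · rintro ⟨i, j⟩ hij
    rw [Finset.mem_antidiagonal] at hij
    obtain ⟨hi, hj, hE⟩ := hij
    have h1 : (Nat.card {y // e y = i} : ZMod 2) ≠ 0 := by rw [← ha.2]; exact hi
    have h2 : (Nat.card {z // f z = j} : ZMod 2) ≠ 0 := by rw [← hb.2]; exact hj
    obtain ⟨⟨y, hy⟩⟩ : Nonempty {y // e y = i} := by
      by_contra hc
      rw [not_nonempty_iff] at hc
      simp at h1
    obtain ⟨⟨z, hz⟩⟩ : Nonempty {z // f z = j} := by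
      by_contra hc
      rw [not_nonempty_iff] at hc
      simp at h2
    refine Finset.mem_image.2 ⟨(y, z), (hSmem _).2 ?_, Prod.ext hy hz⟩
    rw [hy, hz]
    exact hE
  · rintro ⟨i, j⟩ hx hn
    obtain ⟨p, hp, hpx⟩ := Finset.mem_image.1 hx
    have hij : i + j = E := by
      rw [hSmem] at hp
      simp only [g, Prod.mk.injEq] at hpx
      rw [← hpx.1, ← hpx.2, hp]
    by_contra hne
    refine hn (Finset.mem_antidiagonal.2 ⟨?_, ?_, hij⟩)
    · exact fun h => hne (by rw [show a.1.coeff (i, j).1 = 0 from h, zero_mul])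
    · exact fun h => hne (by rw [show b.1.coeff (i, j).2 = 0 from h, mul_zero])

theorem Novikov.coeff_sum {I : Type*} (s : Finset I) (a : I → Novikov) (E : ℝ) :
    (∑ i ∈ s, a i).coeff E = ∑ i ∈ s, (a i).coeff E :=
  map_sum ((HahnSeries.coeff.addMonoidHom (R := ZMod 2) E).comp
    novikovSubring.subtype.toAddMonoidHom) a s

theorem HasNovikovCount.sigma {I : Type*} [Fintype I] {Y : I → Type*} {e : ∀ i, Y i → ℝ}
    {a : I → Novikov} (h : ∀ i, HasNovikovCount (e i) (a i)) :
    HasNovikovCount (fun y : Σ i, Y i => e y.1 y.2) (∑ i, a i) := by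
  refine ⟨fun E => ?_, fun E => ?_⟩
  · refine (finite_iUnion fun i => ((h i).1 E).image (Sigma.mk i)).subset ?_
    rintro ⟨i, y⟩ hy
    exact mem_iUnion.2 ⟨i, y, hy, rfl⟩
  · have hf : ∀ i, Finite {y : Y i // e i y = E} := fun i =>
      (((h i).1 E).subset fun y hy => le_of_eq hy : {y | e i y = E}.Finite).to_subtype
    rw [Novikov.coeff_sum, Finset.sum_congr rfl fun i _ => (h i).2 E, ← Nat.cast_sum,
      ← Nat.card_sigma]
    exact congrArg _ (Nat.card_congr
      { toFun := fun y => ⟨⟨y.1, y.2.1⟩, y.2.2⟩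
        invFun := fun y => ⟨y.1.1, y.1.2, y.2⟩
        left_inv := fun _ => rfl
        right_inv := fun _ => rfl })

/-! ### Transport of morphisms -/

section Cast

variable {Ob : Type u} {M : Ob → Ob → Type v}

theorem castHom_castHom {a a' a'' b b' b'' : Ob} (ha : a = a') (hb : b = b') (ha' : a' = a'')
    (hb' : b' = b'') (x : M a b) :
    castHom M ha' hb' (castHom M ha hb x) = castHom M (ha.trans ha') (hb.trans hb') x := by
  subst ha hb ha' hb'
  rfl

theorem castHom_eq_iff {a a' b b' : Ob} (ha : a = a') (hb : b = b') {x : M a b} {y : M a' b'} :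
    castHom M ha hb x = y ↔ x = castHom M ha.symm hb.symm y := by
  subst ha hb
  rfl

variable {n : ℕ} {L : Fin (n + 1) → Ob} (x : ∀ k : Fin n, M (L k.castSucc) (L k.succ)) {s t : ℕ}
  (h : s + t ≤ n) (y : M (inner L s t h 0) (inner L s t h (Fin.last t)))

theorem outerArgs_left {k : ℕ} (hk : k < s) :
    outerArgs M L x s t h y ⟨k, by omega⟩ =
      castHom M (outer_left L s t h k hk.le).symm (outer_left L s t h (k + 1) hk).symm
        (x ⟨k, by omega⟩) :=
  dif_pos hk

theorem outerArgs_mid :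
    outerArgs M L x s t h y ⟨s, by omega⟩ =
      castHom M (a := inner L s t h 0) (b := inner L s t h (Fin.last t))
        (outer_left L s t h s le_rfl).symm (outer_right L s t h s le_rfl (by omega)).symm y :=
  (dif_neg (lt_irrefl s)).trans (dif_pos rfl)

theorem outerArgs_right {k : ℕ} (hs : s ≤ k) (hk : k + 1 < n - t + 1) :
    outerArgs M L x s t h y ⟨k + 1, hk⟩ =
      castHom M (outer_right L s t h k hs (by omega)).symm
        ((congrArg L (Fin.ext (Nat.add_right_comm k t 1))).trans
          (outer_right L s t h (k + 1) (by omega) hk).symm)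
        (x ⟨k + t, by omega⟩) :=
  (dif_neg (show ¬ k + 1 < s by omega)).trans (dif_neg (show ¬ k + 1 = s by omega))

end Cast

/-- The indices are put in the form `k < s`, `s` or `k + 1` with `s ≤ k`, the shapes in which
`outerArgs` and the axioms on `α` can be rewritten without subtraction. -/
theorem outer_slot_cases {s t n : ℕ} (h : s + t ≤ n) {P : Fin (n - t + 1) → Prop}
    (hl : ∀ k (hk : k < s), P ⟨k, by omega⟩) (hm : P ⟨s, by omega⟩)
    (hr : ∀ k (_ : s ≤ k) (hk : k + 1 < n - t + 1), P ⟨k + 1, hk⟩) (k : Fin (n - t + 1)) : P k := by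
  obtain ⟨k, hk⟩ := k
  rcases lt_trichotomy k s with h1 | rfl | h1
  · exact hl k h1
  · exact hm
  · obtain ⟨j, rfl⟩ : ∃ j, k = j + 1 := ⟨k - 1, by omega⟩
    exact hr j (by omega) hk

theorem slot_cases {s t n : ℕ} (h : s + t ≤ n) {P : Fin n → Prop}
    (hl : ∀ k (hk : k < s), P ⟨k, by omega⟩) (hm : ∀ k (hk : k < t), P ⟨s + k, by omega⟩)
    (hr : ∀ k (_ : s ≤ k) (hk : k + 1 < n - t + 1), P ⟨k + t, by omega⟩) (k : Fin n) : P k := by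
  obtain ⟨k, hk⟩ := k
  by_cases h1 : k < s
  · exact hl k h1
  by_cases h2 : k < s + t
  · obtain ⟨j, rfl⟩ : ∃ j, k = s + j := ⟨k - s, by omega⟩
    exact hm j (by omega)
  · obtain ⟨j, rfl⟩ : ∃ j, k = j + t := ⟨k - t, by omega⟩
    exact hr j (by omega) (by omega)

/-! ### Rigid moduli spaces -/

namespace FlowCategory

variable (C : FlowCategory.{u, v, w}) {n : ℕ} (L : Fin (n + 1) → C.Ob)
  (p : ∀ k : Fin n, C.Mor (L k.castSucc) (L k.succ)) (q : C.Mor (L 0) (L (Fin.last n)))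

/-- The points with asymptotics `p`, `q`. -/
def asymptotics : Set (C.X L) := {χ | (∀ k, C.α k χ = p k) ∧ C.β χ = q}

theorem isClopen_asymptotics : IsClopen (C.asymptotics L p q) := by
  have h1 : IsClopen {χ : C.X L | ∀ k, C.α k χ = p k} := by
    rw [ofPred_forall]
    exact isClopen_iInter_of_finite fun k => (C.isLocallyConstant_α L k).isClopen_fiber (p k)
  exact h1.inter ((C.isLocallyConstant_β L).isClopen_fiber q)

theorem isClopen_dim_eq (d : ℕ) : IsClopen {χ : C.X L | C0Manifold.dim χ = d} :=
  (C0Manifold.isLocallyConstant_dim (X := C.X L)).isClopen_fiber d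

/-- The rigid points of bounded energy form a closed subset of a compact sublevel set, and each of
them is isolated. -/
theorem finite_rigid_sublevel (E : ℝ) : {χ : C.rigid L p q | C.energy χ.1 ≤ E}.Finite := by
  have hc : IsCompact ({χ : C.X L | C.energy χ ≤ E} ∩
      ({χ | C0Manifold.dim χ = 0} ∩ C.asymptotics L p q)) :=
    (C.isCompact_sublevel L E).inter_right
      ((C.isClopen_dim_eq L 0).isClosed.inter (C.isClopen_asymptotics L p q).isClosed)
  have hf := hc.induction_on (p := fun s => (s ∩ {χ | C0Manifold.dim χ = 0}).Finite) (by simp)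
    (fun s t hst h => h.subset (inter_subset_inter_left _ hst))
    (fun s t hs ht => by rw [union_inter_distrib_right]; exact hs.union ht)
    (fun χ hχ => ⟨{χ}, mem_nhdsWithin_of_mem_nhds
      ((C0Manifold.isOpen_singleton_of_dim_zero hχ.2.1).mem_nhds rfl),
      (finite_singleton χ).subset inter_subset_left⟩)
  refine Set.Finite.of_injOn (f := Subtype.val) (fun χ hχ => ?_) Subtype.val_injective.injOn hf
  exact ⟨⟨hχ, χ.2⟩, χ.2.1⟩

/-- The one-dimensional part with given asymptotics and energy. -/
def oneDim (E : ℝ) : Set (C.X L) :=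
  {χ | C.energy χ = E} ∩ ({χ | C0Manifold.dim χ = 1} ∩ C.asymptotics L p q)

theorem even_ncard_boundary (E : ℝ) :
    Even (C.oneDim L p q E ∩ C0Manifold.boundary (C.X L)).ncard := by
  have := C0Manifold.t2 (X := C.X L)
  have hE : IsClopen {χ : C.X L | C.energy χ = E} :=
    (C.isLocallyConstant_energy L).isClopen_fiber E
  have hclopen : IsClopen (C.oneDim L p q E) :=
    hE.inter ((C.isClopen_dim_eq L 1).inter (C.isClopen_asymptotics L p q))
  have hcompact : IsCompact (C.oneDim L p q E) :=
    (C.isCompact_sublevel L E).of_isClosed_subset hclopen.isClosed fun χ hχ => le_of_eq hχ.1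
  have h := even_ncard_isEnd hcompact hclopen.isOpen
    fun χ hχ => C0Manifold.exists_chart_of_dim hχ.2.1
  convert h using 2
  ext χ
  exact and_congr_right fun hχ => C0Manifold.mem_boundary_iff_isEnd hχ.2.1

/-! ### Rigid broken configurations as boundary points -/

section Broken

variable {s t : ℕ} (h : s + t ≤ n)

/-- The target of the outer factor. -/
def outerTarget : C.Mor (outer L s t h 0) (outer L s t h (Fin.last (n - t + 1))) :=
  castHom C.Mor (insertion_outer_inner L s t h).outer_zero.symm
    (insertion_outer_inner L s t h).outer_last.symm q

/-- The rigid broken configurations at the slot `(s, t)`. -/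
abbrev Broken (s t : ℕ) (h : s + t ≤ n) : Type _ :=
  Σ r : C.Mor (inner L s t h 0) (inner L s t h (Fin.last t)),
    C.rigid (outer L s t h) (outerArgs C.Mor L p s t h r) (C.outerTarget L q h) ×
      C.rigid (inner L s t h) (innerArgs C.Mor L p s t h) r

/-- The energy of a broken configuration. -/
def brokenEnergy (b : C.Broken L p q s t h) : ℝ := C.energy b.2.1.1 + C.energy b.2.2.1

variable {L p q h}

/-- Both evaluations at the node equal the intermediate generator `r`, up to transport. -/
theorem mem_fiberProduct_of_broken (b : C.Broken L p q s t h) :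
    (b.2.1.1, b.2.2.1) ∈ C.fiberProduct (insertion_outer_inner L s t h) := by
  obtain ⟨r, χ', χ''⟩ := b
  change C.slotα _ χ'.1 = C.slotβ _ χ''.1
  rw [PreFlowCategory.slotα, PreFlowCategory.slotβ, χ'.2.2.1, outerArgs_mid, χ''.2.2.2]
  exact castHom_castHom (M := C.Mor) _ _ _ _ r

/-- The fiber product point of a broken configuration. -/
def glue (b : C.Broken L p q s t h) : C.fiberProduct (insertion_outer_inner L s t h) :=
  ⟨(b.2.1.1, b.2.2.1), C.mem_fiberProduct_of_broken b⟩

theorem dim_glue (b : C.Broken L p q s t h) : C0Manifold.dim (C.glue b) = 0 := by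
  change C0Manifold.dim b.2.1.1 + C0Manifold.dim b.2.2.1 = 0
  rw [b.2.1.2.1, b.2.2.2.1]

theorem glue_injective : Function.Injective (C.glue (L := L) (p := p) (q := q) (h := h)) := by
  rintro ⟨r, ⟨χ', h1⟩, ⟨χ'', h2⟩⟩ ⟨r₁, ⟨χ₁', h1'⟩, ⟨χ₁'', h2'⟩⟩ hb
  have hb' := congrArg Subtype.val hb
  simp only [glue, Prod.mk.injEq] at hb'
  obtain ⟨rfl, rfl⟩ := hb'
  obtain rfl : r = r₁ := h2.2.2.symm.trans h2'.2.2
  rfl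

theorem energy_glue (b : C.Broken L p q s t h) :
    C.energy (C.φ _ (C.glue b)) = C.brokenEnergy L p q h b :=
  C.energy_φ _ _

theorem glue_mem_asymptotics (b : C.Broken L p q s t h) :
    C.φ _ (C.glue b) ∈ C.asymptotics L p q := by
  refine ⟨slot_cases h (fun k hk => ?_) (fun k hk => ?_) (fun k hs hk => ?_), ?_⟩
  · rw [C.α_φ_left _ _ k hk]
    change castHom C.Mor _ _ (C.α _ b.2.1.1) = _
    rw [b.2.1.2.2.1, outerArgs_left p h _ hk, castHom_castHom]
    rfl
  · rw [C.α_φ_mid _ _ k hk]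
    change castHom C.Mor _ _ (C.α _ b.2.2.1) = _
    rw [b.2.2.2.2.1]
    rfl
  · rw [C.α_φ_right _ _ k hs hk]
    change castHom C.Mor _ _ (C.α _ b.2.1.1) = _
    rw [b.2.1.2.2.1, outerArgs_right p h _ hs hk, castHom_castHom]
    rfl
  · rw [C.β_φ]
    change castHom C.Mor _ _ (C.β b.2.1.1) = _
    rw [b.2.1.2.2.2, outerTarget, castHom_castHom]
    rfl

/-- The intermediate generator is `β(χ'')`. The evaluation axioms, read backwards, give the
asymptotics of both factors, and a vanishing sum of dimensions forces both dimensions to vanish. -/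
theorem exists_broken (y : C.fiberProduct (insertion_outer_inner L s t h))
    (hy : C0Manifold.dim y = 0) (hφ : C.φ _ y ∈ C.asymptotics L p q) :
    ∃ b : C.Broken L p q s t h, C.glue b = y := by
  obtain ⟨⟨χ', χ''⟩, hfib⟩ := y
  obtain ⟨hα, hβ⟩ := hφ
  have hdim : C0Manifold.dim χ' + C0Manifold.dim χ'' = 0 := hy
  have hout : ∀ k, C.α k χ' = outerArgs C.Mor L p s t h (C.β χ'') k := by
    refine outer_slot_cases h (fun k hk => ?_) ?_ (fun k hs hk => ?_)
    · have h1 := C.α_φ_left _ ⟨(χ', χ''), hfib⟩ k hk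
      rw [hα] at h1
      rw [outerArgs_left p h _ hk]
      exact (castHom_eq_iff _ _).1 h1.symm
    · rw [outerArgs_mid]
      have h1 : castHom C.Mor _ _ (C.α ⟨s, by omega⟩ χ') = castHom C.Mor _ _ (C.β χ'') := hfib
      exact ((castHom_eq_iff _ _).1 h1).trans (castHom_castHom (M := C.Mor) _ _ _ _ (C.β χ''))
    · have h1 := C.α_φ_right _ ⟨(χ', χ''), hfib⟩ k hs hk
      rw [hα] at h1
      rw [outerArgs_right p h _ hs hk]
      exact (castHom_eq_iff _ _).1 h1.symm
  have hin : ∀ k, C.α k χ'' = innerArgs C.Mor L p s t h k := by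
    rintro ⟨k, hk⟩
    have h1 := C.α_φ_mid _ ⟨(χ', χ''), hfib⟩ k hk
    rw [hα] at h1
    exact h1.symm
  have hq : C.β χ' = C.outerTarget L q h := by
    have h1 := C.β_φ _ ⟨(χ', χ''), hfib⟩
    rw [hβ] at h1
    exact (castHom_eq_iff _ _).1 h1.symm
  exact ⟨⟨C.β χ'', ⟨χ', by omega, hout, hq⟩, ⟨χ'', by omega, hin, rfl⟩⟩, rfl⟩

end Broken

/-- Gluing is a bijection onto the boundary of the one-dimensional part: injective because
zero-dimensional face points are interior to their faces, whose interiors have disjoint images, and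
surjective because every boundary point there lies on a face. -/
theorem even_card_broken (E : ℝ) :
    Even (Nat.card {b : Σ st : Slot n, C.Broken L p q st.1.1.val st.1.2.val st.2 //
      C.brokenEnergy L p q b.1.2 b.2 = E}) := by
  have hF : IsBoundaryFaceSystem
    fun st : Slot n => C.φ (insertion_outer_inner L st.1.1.val st.1.2.val st.2) := C.boundaryFaces L
  have he := C.even_ncard_boundary L p q E
  rw [← Nat.card_coe_set_eq] at he
  convert he using 1
  refine Nat.card_eq_of_bijective (fun b => ⟨C.φ _ (C.glue b.1.2),
    ⟨(C.energy_glue b.1.2).trans b.2, (hF.dim_eq_one_iff b.1.1 _).2 (C.dim_glue b.1.2),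
      C.glue_mem_asymptotics b.1.2⟩, hF.mem_boundary b.1.1 _⟩) ⟨?_, ?_⟩
  · rintro ⟨⟨st, b⟩, hb⟩ ⟨⟨st', b'⟩, hb'⟩ hbb
    have h1 := congrArg Subtype.val hbb
    obtain rfl : st = st' := hF.eq_of_eq (C.dim_glue b) (C.dim_glue b') h1
    obtain rfl : b = b' := C.glue_injective ((hF.isEmbedding st).injective h1)
    rfl
  · rintro ⟨χ, ⟨hE, h1, has⟩, hb⟩
    obtain ⟨st, y, rfl⟩ := hF.exists_face h1 hb
    obtain ⟨b, rfl⟩ := C.exists_broken y ((hF.dim_eq_one_iff st y).1 h1) has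
    exact ⟨⟨⟨st, b⟩, (C.energy_glue b).symm.trans hE⟩, rfl⟩

end FlowCategory

/-! ### Multilinearity of insertions -/

section Insert

variable {Ob : Type u} {M : Ob → Ob → Type v} {n : ℕ} {L : Fin (n + 1) → Ob}
  (x : ∀ k : Fin n, M (L k.castSucc) (L k.succ)) {s t : ℕ} (h : s + t ≤ n)
  (y y' : M (inner L s t h 0) (inner L s t h (Fin.last t)))

/-- The inserted element occupies one slot, so a multilinear map applied to `outerArgs` is linear in
it; the reference value `y'` is immaterial. -/
theorem outerArgs_eq_update : outerArgs M L x s t h y =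
    Function.update (outerArgs M L x s t h y') ⟨s, by omega⟩
      (castHom M (a := inner L s t h 0) (b := inner L s t h (Fin.last t))
        (outer_left L s t h s le_rfl).symm (outer_right L s t h s le_rfl (by omega)).symm y) := by
  funext k
  revert k
  refine outer_slot_cases h (fun k hk => ?_) ?_ (fun k hs hk => ?_)
  · rw [Function.update_of_ne (by simp only [ne_eq, Fin.mk.injEq]; omega),
      outerArgs_left x h _ hk, outerArgs_left x h _ hk]
  · rw [Function.update_self, outerArgs_mid]
  · rw [Function.update_of_ne (by simp only [ne_eq, Fin.mk.injEq]; omega),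
      outerArgs_right x h _ hs hk, outerArgs_right x h _ hs hk]

theorem outerArgs_update_left {k : ℕ} (hk : k < s)
    (v : M (L (Fin.castSucc ⟨k, by omega⟩)) (L (Fin.succ ⟨k, by omega⟩))) :
    outerArgs M L (Function.update x ⟨k, by omega⟩ v) s t h y =
      Function.update (outerArgs M L x s t h y) ⟨k, by omega⟩
        (castHom M (outer_left L s t h k hk.le).symm (outer_left L s t h (k + 1) hk).symm v) := by
  funext j
  revert j
  refine outer_slot_cases h (fun j hj => ?_) ?_ (fun j hs hj => ?_)
  · rw [outerArgs_left _ h _ hj]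
    by_cases hjk : j = k
    · subst hjk
      rw [Function.update_self, Function.update_self]
    · rw [Function.update_of_ne (by simpa using hjk), Function.update_of_ne (by simpa using hjk),
        outerArgs_left _ h _ hj]
  · rw [Function.update_of_ne (by simp only [ne_eq, Fin.mk.injEq]; omega), outerArgs_mid,
      outerArgs_mid]
  · rw [outerArgs_right _ h _ hs hj, Function.update_of_ne (by simp only [ne_eq, Fin.mk.injEq]; omega),
      Function.update_of_ne (by simp only [ne_eq, Fin.mk.injEq]; omega), outerArgs_right _ h _ hs hj]

theorem outerArgs_update_mid {k : ℕ} (hk : k < t)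
    (v : M (L (Fin.castSucc ⟨s + k, by omega⟩)) (L (Fin.succ ⟨s + k, by omega⟩))) :
    outerArgs M L (Function.update x ⟨s + k, by omega⟩ v) s t h y = outerArgs M L x s t h y := by
  funext j
  revert j
  refine outer_slot_cases h (fun j hj => ?_) ?_ (fun j hs hj => ?_)
  · rw [outerArgs_left _ h _ hj, outerArgs_left _ h _ hj,
      Function.update_of_ne (by simp only [ne_eq, Fin.mk.injEq]; omega)]
  · rw [outerArgs_mid, outerArgs_mid]
  · rw [outerArgs_right _ h _ hs hj, outerArgs_right _ h _ hs hj,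
      Function.update_of_ne (by simp only [ne_eq, Fin.mk.injEq]; omega)]

theorem outerArgs_update_right {k : ℕ} (hs : s ≤ k) (hk : k + 1 < n - t + 1)
    (v : M (L (Fin.castSucc ⟨k + t, by omega⟩)) (L (Fin.succ ⟨k + t, by omega⟩))) :
    outerArgs M L (Function.update x ⟨k + t, by omega⟩ v) s t h y =
      Function.update (outerArgs M L x s t h y) ⟨k + 1, hk⟩
        (castHom M (outer_right L s t h k hs (by omega)).symm
          ((congrArg L (Fin.ext (Nat.add_right_comm k t 1))).trans
            (outer_right L s t h (k + 1) (by omega) hk).symm) v) := by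
  funext j
  revert j
  refine outer_slot_cases h (fun j hj => ?_) ?_ (fun j hs' hj => ?_)
  · rw [outerArgs_left _ h _ hj, Function.update_of_ne (by simp only [ne_eq, Fin.mk.injEq]; omega),
      Function.update_of_ne (by simp only [ne_eq, Fin.mk.injEq]; omega), outerArgs_left _ h _ hj]
  · rw [Function.update_of_ne (by simp only [ne_eq, Fin.mk.injEq]; omega), outerArgs_mid,
      outerArgs_mid]
  · rw [outerArgs_right _ h _ hs' hj]
    by_cases hjk : j = k
    · subst hjk
      rw [Function.update_self, Function.update_self]
    · rw [Function.update_of_ne (by simpa using hjk), Function.update_of_ne (by simpa using hjk),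
        outerArgs_right _ h _ hs' hj]

theorem innerArgs_update_of_ne {k : Fin n} (hk : ∀ j : Fin t, (⟨s + j.val, by omega⟩ : Fin n) ≠ k)
    (v : M (L k.castSucc) (L k.succ)) :
    innerArgs M L (Function.update x k v) s t h = innerArgs M L x s t h :=
  funext fun j => Function.update_of_ne (β := fun k : Fin n => M (L k.castSucc) (L k.succ))
    (hk j) v x

theorem innerArgs_update_mid {k : ℕ} (hk : k < t)
    (v : M (L (Fin.castSucc ⟨s + k, by omega⟩)) (L (Fin.succ ⟨s + k, by omega⟩))) :
    innerArgs M L (Function.update x ⟨s + k, by omega⟩ v) s t h =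
      Function.update (innerArgs M L x s t h) ⟨k, hk⟩ v := by
  funext j
  by_cases hj : j = ⟨k, hk⟩
  · subst hj
    exact (Function.update_self (β := fun k : Fin n => M (L k.castSucc) (L k.succ)) _ _ _).trans
      (Function.update_self (β := fun k : Fin t => M (inner L s t h k.castSucc)
        (inner L s t h k.succ)) (⟨k, hk⟩ : Fin t) v _).symm
  · have hj' : (⟨s + j.val, by omega⟩ : Fin n) ≠ ⟨s + k, by omega⟩ := by
      intro hc
      simp only [Fin.mk.injEq] at hc
      exact hj (Fin.ext (by simp only; omega))
    exact (Function.update_of_ne (β := fun k : Fin n => M (L k.castSucc) (L k.succ))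
      hj' v x).trans (Function.update_of_ne (β := fun k : Fin t => M (inner L s t h k.castSucc)
        (inner L s t h k.succ)) hj v (innerArgs M L x s t h)).symm

variable {Λ : Type*} [CommRing Λ] [∀ a b, AddCommGroup (M a b)] [∀ a b, Module Λ (M a b)]

variable (Λ M) in
/-- Transport along equalities of objects, as a linear map. -/
noncomputable def castLinear {a a' b b' : Ob} (ha : a = a') (hb : b = b') : M a b →ₗ[Λ] M a' b' where
  toFun := castHom M ha hb
  map_add' _ _ := by subst ha hb; rfl
  map_smul' _ _ := by subst ha hb; rfl

variable (μ' : MultilinearMap Λ (fun k : Fin (n - t + 1) =>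
    M (outer L s t h k.castSucc) (outer L s t h k.succ))
    (M (outer L s t h 0) (outer L s t h (Fin.last (n - t + 1)))))
  (μ'' : MultilinearMap Λ (fun k : Fin t => M (inner L s t h k.castSucc) (inner L s t h k.succ))
    (M (inner L s t h 0) (inner L s t h (Fin.last t))))

/-- `μ'(x_1, …, y, …, x_n)` as a linear function of the inserted element `y`. -/
noncomputable def insertLinear : M (inner L s t h 0) (inner L s t h (Fin.last t)) →ₗ[Λ]
    M (L 0) (L (Fin.last n)) :=
  (castLinear M Λ (insertion_outer_inner L s t h).outer_zero
    (insertion_outer_inner L s t h).outer_last).comp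
  ((μ'.toLinearMap (outerArgs M L x s t h 0) ⟨s, by omega⟩).comp
    (castLinear M Λ (a := inner L s t h 0) (b := inner L s t h (Fin.last t))
      (outer_left L s t h s le_rfl).symm (outer_right L s t h s le_rfl (by omega)).symm))

theorem insertLinear_apply : insertLinear x h μ' y =
    castHom M (insertion_outer_inner L s t h).outer_zero
      (insertion_outer_inner L s t h).outer_last (μ' (outerArgs M L x s t h y)) := by
  rw [outerArgs_eq_update x h y 0]
  rfl

/-- Each input enters exactly once: in the outer operation to the left of the slot, in the inner
operation, or in the outer operation to its right. The last two forms are linear compositions, as is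
the first. -/
theorem exists_linear_update (k : Fin n) :
    ∃ ℓ : M (L k.castSucc) (L k.succ) →ₗ[Λ] M (L 0) (L (Fin.last n)), ∀ v,
      insertLinear (Function.update x k v) h μ' (μ'' (innerArgs M L (Function.update x k v) s t h)) =
        ℓ v := by
  revert k
  refine slot_cases h (fun k hk => ?_) (fun k hk => ?_) (fun k hs hk => ?_)
  · refine ⟨(castLinear M Λ (insertion_outer_inner L s t h).outer_zero
      (insertion_outer_inner L s t h).outer_last).comp
      ((μ'.toLinearMap (outerArgs M L x s t h (μ'' (innerArgs M L x s t h))) ⟨k, by omega⟩).comp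
        (castLinear M Λ (outer_left L s t h k hk.le).symm
          (outer_left L s t h (k + 1) hk).symm)), fun v => ?_⟩
    rw [innerArgs_update_of_ne x h
      (by intro j; simp only [ne_eq, Fin.mk.injEq]; omega), insertLinear_apply,
      outerArgs_update_left x h _ hk]
    rfl
  · refine ⟨(insertLinear x h μ').comp (μ''.toLinearMap (innerArgs M L x s t h) ⟨k, hk⟩),
      fun v => ?_⟩
    rw [innerArgs_update_mid x h hk, insertLinear_apply, outerArgs_update_mid x h _ hk,
      ← insertLinear_apply]
    rfl
  · refine ⟨(castLinear M Λ (insertion_outer_inner L s t h).outer_zero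
      (insertion_outer_inner L s t h).outer_last).comp
      ((μ'.toLinearMap (outerArgs M L x s t h (μ'' (innerArgs M L x s t h))) ⟨k + 1, hk⟩).comp
        (castLinear M Λ (outer_right L s t h k hs (by omega)).symm
          ((congrArg L (Fin.ext (Nat.add_right_comm k t 1))).trans
            (outer_right L s t h (k + 1) (by omega) hk).symm))), fun v => ?_⟩
    rw [innerArgs_update_of_ne x h
      (by intro j; simp only [ne_eq, Fin.mk.injEq]; omega), insertLinear_apply,
      outerArgs_update_right x h _ hs hk]
    rfl

/-- The insertion of `μ''` into `μ'`, as a multilinear map. -/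
noncomputable def insertMultilinear : MultilinearMap Λ (fun k : Fin n => M (L k.castSucc) (L k.succ))
    (M (L 0) (L (Fin.last n))) where
  toFun x := insertLinear x h μ' (μ'' (innerArgs M L x s t h))
  map_update_add' {inst} x k v v' := by
    -- The multilinearity axioms quantify over the decidability instance used by `Function.update`;
    -- all such instances coincide.
    obtain rfl := Subsingleton.elim inst (instDecidableEqFin n)
    obtain ⟨ℓ, hℓ⟩ := exists_linear_update x h μ' μ'' k
    rw [hℓ, hℓ, hℓ, map_add]
  map_update_smul' {inst} x k c v := by
    obtain rfl := Subsingleton.elim inst (instDecidableEqFin n)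
    obtain ⟨ℓ, hℓ⟩ := exists_linear_update x h μ' μ'' k
    rw [hℓ, hℓ, map_smul]

theorem insertMultilinear_apply : insertMultilinear h μ' μ'' x =
    castHom M (insertion_outer_inner L s t h).outer_zero
      (insertion_outer_inner L s t h).outer_last
      (μ' (outerArgs M L x s t h (μ'' (innerArgs M L x s t h)))) :=
  insertLinear_apply x h _ μ'

end Insert

/-! ### Multilinear maps on free modules -/

section Free

variable {Ob : Type u} {S : Ob → Ob → Type v} {Λ : Type*} [CommRing Λ]

theorem castHom_single {a a' b b' : Ob} (ha : a = a') (hb : b = b') (p : S a b) (c : Λ) :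
    castHom (fun a b => S a b →₀ Λ) ha hb (Finsupp.single p c) =
      Finsupp.single (castHom S ha hb p) c := by
  subst ha hb
  rfl

theorem castHom_finsupp_apply {a a' b b' : Ob} (ha : a = a') (hb : b = b') (f : S a b →₀ Λ)
    (q : S a' b') : castHom (fun a b => S a b →₀ Λ) ha hb f q =
      f (castHom S ha.symm hb.symm q) := by
  subst ha hb
  rfl

theorem outerArgs_single {n : ℕ} {L : Fin (n + 1) → Ob}
    (p : ∀ k : Fin n, S (L k.castSucc) (L k.succ)) {s t : ℕ} (h : s + t ≤ n)
    (r : S (inner L s t h 0) (inner L s t h (Fin.last t))) :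
    outerArgs (fun a b => S a b →₀ Λ) L (fun k => Finsupp.single (p k) 1) s t h
      (Finsupp.single r 1) = fun k => Finsupp.single (outerArgs S L p s t h r k) 1 := by
  funext k
  revert k
  refine outer_slot_cases h (fun k hk => ?_) ?_ (fun k hs hk => ?_)
  · rw [outerArgs_left _ h _ hk, outerArgs_left _ h _ hk, castHom_single]
  · rw [outerArgs_mid, outerArgs_mid]
    exact castHom_single (S := S) _ _ r 1
  · rw [outerArgs_right _ h _ hs hk, outerArgs_right _ h _ hs hk, castHom_single]

variable {ι : Type*} [Fintype ι] {I : ι → Type*} {N : Type*} [AddCommGroup N]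
  [Module Λ N]

open Classical in
/-- The multilinear map with given values on tuples of generators. -/
noncomputable def multilinearOfValues [∀ k, Finite (I k)] (g : (∀ k, I k) → N) : MultilinearMap Λ (fun k => I k →₀ Λ) N :=
  letI := Fintype.ofFinite (∀ k, I k)
  ∑ p : ∀ k, I k, ((MultilinearMap.mkPiAlgebra Λ ι Λ).compLinearMap
    fun k => Finsupp.lapply (p k)).smulRight (g p)

theorem multilinearOfValues_single [∀ k, Finite (I k)] (g : (∀ k, I k) → N) (p : ∀ k, I k) :
    multilinearOfValues (Λ := Λ) g (fun k => Finsupp.single (p k) 1) = g p := by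
  classical
  let := Fintype.ofFinite (∀ k, I k)
  rw [multilinearOfValues, sum_apply, Finset.sum_eq_single p]
  · simp
  · intro p' _ hne
    obtain ⟨k, hk⟩ := Function.ne_iff.1 hne
    rw [MultilinearMap.smulRight_apply, MultilinearMap.compLinearMap_apply,
      MultilinearMap.mkPiAlgebra_apply, Finset.prod_eq_zero (Finset.mem_univ k), zero_smul]
    simp [Ne.symm hk]
  · simp

theorem multilinear_ext_single {f g : MultilinearMap Λ (fun k => I k →₀ Λ) N}
    (h : ∀ p : ∀ k, I k, f (fun k => Finsupp.single (p k) 1) = g fun k => Finsupp.single (p k) 1) :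
    f = g :=
  Module.Basis.ext_multilinear (fun _ => Finsupp.basisSingleOne) fun p => by
    simpa using h p

end Free

/-! ### The linear category of a flow category -/

namespace FlowCategory

variable (C : FlowCategory.{u, v, w}) {n : ℕ} (L : Fin (n + 1) → C.Ob)

theorem exists_count (p : ∀ k : Fin n, C.Mor (L k.castSucc) (L k.succ))
    (q : C.Mor (L 0) (L (Fin.last n))) :
    ∃ a, HasNovikovCount (fun χ : C.rigid L p q => C.energy χ.1) a :=
  exists_hasNovikovCount (C.finite_rigid_sublevel L p q)

/-- The Novikov count of rigid points. -/
noncomputable def count (p : ∀ k : Fin n, C.Mor (L k.castSucc) (L k.succ))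
    (q : C.Mor (L 0) (L (Fin.last n))) : Novikov :=
  (C.exists_count L p q).choose

theorem hasNovikovCount_count (p : ∀ k : Fin n, C.Mor (L k.castSucc) (L k.succ))
    (q : C.Mor (L 0) (L (Fin.last n))) :
    HasNovikovCount (fun χ : C.rigid L p q => C.energy χ.1) (C.count L p q) :=
  (C.exists_count L p q).choose_spec

/-- The `A_∞`-compositions. -/
noncomputable def composition : MultilinearMap Novikov
    (fun k : Fin n => C.Mor (L k.castSucc) (L k.succ) →₀ Novikov)
    (C.Mor (L 0) (L (Fin.last n)) →₀ Novikov) :=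
  multilinearOfValues fun p => Finsupp.equivFunOnFinite.symm (C.count L p)

theorem composition_single (p : ∀ k : Fin n, C.Mor (L k.castSucc) (L k.succ)) :
    C.composition L (fun k => Finsupp.single (p k) 1) =
      Finsupp.equivFunOnFinite.symm (C.count L p) :=
  multilinearOfValues_single _ p

/-- The insertion of the inner composition into the outer one. -/
noncomputable def compositionInsert {s t : ℕ} (h : s + t ≤ n) : MultilinearMap Novikov
    (fun k : Fin n => C.Mor (L k.castSucc) (L k.succ) →₀ Novikov)
    (C.Mor (L 0) (L (Fin.last n)) →₀ Novikov) :=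
  insertMultilinear (M := fun a b => C.Mor a b →₀ Novikov) (Λ := Novikov) h
    (C.composition (outer L s t h)) (C.composition (inner L s t h))

/-- Expanding the inner composition in generators `r` and using linearity in the inserted slot gives
a sum over `r` of products of two counts, which is the count of the disjoint union over `r` of
products of rigid sets. -/
theorem hasNovikovCount_broken (p : ∀ k : Fin n, C.Mor (L k.castSucc) (L k.succ))
    (q : C.Mor (L 0) (L (Fin.last n))) {s t : ℕ} (h : s + t ≤ n) :
    HasNovikovCount (C.brokenEnergy L p q h)
      (C.compositionInsert L h (fun k => Finsupp.single (p k) 1) q) := by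
  let := Fintype.ofFinite (C.Mor (inner L s t h 0) (inner L s t h (Fin.last t)))
  have hin : C.composition (inner L s t h)
      (innerArgs (fun a b => C.Mor a b →₀ Novikov) L (fun k => Finsupp.single (p k) 1) s t h) =
      ∑ r, C.count (inner L s t h) (innerArgs C.Mor L p s t h) r • Finsupp.single r 1 := by
    refine (C.composition_single (inner L s t h) (innerArgs C.Mor L p s t h)).trans ?_
    refine Finsupp.ext fun r => ?_
    rw [Finsupp.finsetSum_apply, Finset.sum_eq_single r (fun r' _ hne => by simp [hne.symm])
      (by simp)]
    simp
  have hval : C.compositionInsert L h (fun k => Finsupp.single (p k) 1) q =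
      ∑ r, C.count (outer L s t h) (outerArgs C.Mor L p s t h r) (C.outerTarget L q h) *
        C.count (inner L s t h) (innerArgs C.Mor L p s t h) r := by
    change insertLinear (M := fun a b => C.Mor a b →₀ Novikov) (Λ := Novikov) _ h
      (C.composition (outer L s t h)) (C.composition (inner L s t h) _) q = _
    rw [hin, map_sum, Finsupp.finsetSum_apply]
    refine Finset.sum_congr rfl fun r _ => ?_
    rw [map_smul, Finsupp.smul_apply, insertLinear_apply, castHom_finsupp_apply, outerArgs_single,
      C.composition_single, smul_eq_mul, mul_comm]
    rfl
  rw [hval]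
  exact HasNovikovCount.sigma fun r => (C.hasNovikovCount_count _ _ _).prod
    (C.hasNovikovCount_count _ _ _)

/-- Both sides are multilinear, so generators suffice. There each coefficient is the Novikov count
of all broken configurations, whose level sets are even. -/
theorem sum_insert_eq_zero : ∑ st : Slot n, C.compositionInsert L st.2 = 0 := by
  refine multilinear_ext_single fun p => Finsupp.ext fun q => ?_
  rw [sum_apply, Finsupp.finsetSum_apply]
  exact (HasNovikovCount.sigma fun st : Slot n => C.hasNovikovCount_broken L p q st.2).eq_zero
    (C.even_card_broken L p q)

/-- The linear `A_∞`-category of a flow category. -/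
noncomputable def linearCategory : LinearAInftyCategory Novikov C.Ob (fun a b => C.Mor a b →₀ Novikov) where
  μ L := C.composition L
  equation L x := by
    have h := congrArg (fun f => f x) (C.sum_insert_eq_zero L)
    rw [sum_apply] at h
    refine Eq.trans (Finset.sum_congr rfl fun st _ => ?_) h
    exact (insertMultilinear_apply (M := fun a b => C.Mor a b →₀ Novikov) (Λ := Novikov) x st.2
      _ _).symm

end FlowCategory

end AInfty

/-- The Novikov count condition includes finiteness of sublevel sets and fixes every coefficient on
generators, so it pins down the compositions; the `A_∞`-equations are propositions and add no
further freedom. -/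
theorem mainTheorem2 (C : AInfty.FlowCategory.{u, v, w}) :
    ∃! A : AInfty.LinearAInftyCategory AInfty.Novikov C.Ob
        (fun a b => C.Mor a b →₀ AInfty.Novikov),
      ∀ (n : ℕ) (L : Fin (n + 1) → C.Ob) (p : ∀ k : Fin n, C.Mor (L k.castSucc) (L k.succ))
        (q : C.Mor (L 0) (L (Fin.last n))),
        AInfty.HasNovikovCount (fun χ : C.rigid L p q => C.energy χ.1)
          (A.μ L (fun k => Finsupp.single (p k) 1) q) := by
  refine ⟨C.linearCategory, fun n L p q => ?_, fun A hA => ?_⟩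
  · change AInfty.HasNovikovCount _ (C.composition L _ q)
    rw [C.composition_single]
    exact C.hasNovikovCount_count L p q
  · refine AInfty.LinearAInftyCategory.ext ?_
    funext n L
    refine AInfty.multilinear_ext_single fun p => Finsupp.ext fun q => (hA n L p q).unique ?_
    change AInfty.HasNovikovCount _ (C.composition L _ q)
    rw [C.composition_single]
    exact C.hasNovikovCount_count L p q
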